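/- Let $M$ be a compact connected oriented smooth surface with boundary $\partial M$ and let $x:M\to\mathbb R^3$ be a smooth immersion with Gauss map (unit normal field) $N:M\to\mathbb R^3$ and mean curvature $H$, the average of the principal curvatures, i.e. $2H$ is the trace of the shape operator $-dN$. Let $a,b\in\mathbb R$ and suppose that $M$ is a stationary rotating surface with respect to the $x_3$-axis, i.e. that $$2H(p)=a\,r(p)^2+b\qquad\text{for all }p\in M,$$ where $r=\sqrt{x_1^2+x_2^2}$ is the distance of $x(p)$ from the $x_3$-axis. Let $R>0$ and let $\Gamma$ be a horizontal circle of radius $R$ centred at the $x_3$-axis, $\Gamma=\{x_1^2+x_2^2=R^2,\ x_3=c\}$ for some $c\in\mathbb R$. Suppose that $\Gamma$ is the boundary of $M$, i.e. that $x|_{\partial M}:\partial M\to\mathbb R^3$ is an embedding with $x(\partial M)=\Gamma$. Then $$|aR^2+2b|\le\frac4R .$$ In particular, if $a=0$, then the (constant) mean curvature satisfies Heinz's bound $|H|\le 1/R$. -/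

import Mathlib

open scoped Manifold ContDiff

noncomputable section

namespace RotatingSurface

/-- Euclidean three-space; the coordinates `x₁, x₂, x₃` are `y 0, y 1, y 2`. -/
abbrev Space : Type := EuclideanSpace ℝ (Fin 3)

/-- The distance `r = √(x₁² + x₂²)` from a point to the `x₃`-axis. -/
def axisDist (y : Space) : ℝ := √(y 0 ^ 2 + y 1 ^ 2)

/-- The horizontal circle of radius `R` centred at the point `(0, 0, c)` of the `x₃`-axis. -/
def horizontalCircle (R c : ℝ) : Set Space := {y | axisDist y = R ∧ y 2 = c}

section Surface

variable {M : Type*} [TopologicalSpace M] [ChartedSpace (EuclideanHalfSpace 2) M]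

/-- The differential at `p` of a map from a surface with boundary to three-space. The tangent space
of `M` at `p` is identified with `ℝ²` through the preferred chart at `p`. -/
def differential (f : M → Space) (p : M) : EuclideanSpace ℝ (Fin 2) →L[ℝ] Space :=
  mfderiv (𝓡∂ 2) 𝓘(ℝ, Space) f p

/-- The `i`-th coordinate tangent vector at a point. -/
def coordVec (i : Fin 2) : EuclideanSpace ℝ (Fin 2) := EuclideanSpace.single i 1

/-- `N` is a Gauss map of `x : M → ℝ³`: a smooth unit normal vector field along `x`. For an
immersed surface in three-space, choosing an orientation is the same as choosing such an `N`. -/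
structure IsGaussMap (x N : M → Space) : Prop where
  contMDiff : ContMDiff (𝓡∂ 2) 𝓘(ℝ, Space) ∞ N
  norm_eq_one : ∀ p, ‖N p‖ = 1
  orthogonal : ∀ p v, inner ℝ (differential x p v) (N p) = 0

/-- The matrix `⟨dx(eᵢ), dx(eⱼ)⟩` of the first fundamental form. -/
def firstForm (x : M → Space) (p : M) : Matrix (Fin 2) (Fin 2) ℝ :=
  Matrix.of fun i j => inner ℝ (differential x p (coordVec i)) (differential x p (coordVec j))

/-- The matrix `-⟨dN(eᵢ), dx(eⱼ)⟩` of the second fundamental form. -/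
def secondForm (x N : M → Space) (p : M) : Matrix (Fin 2) (Fin 2) ℝ :=
  Matrix.of fun i j => -inner ℝ (differential N p (coordVec i)) (differential x p (coordVec j))

/-- The mean curvature `H`: half the trace of the shape operator `-dN`, which has matrix
`I⁻¹ II` (up to transposition) in coordinates; the average of the principal curvatures. With this
sign the unit sphere has `H = 1` for the inward normal. -/
def meanCurvature (x N : M → Space) (p : M) : ℝ :=
  ((firstForm x p)⁻¹ * secondForm x N p).trace / 2

/-- The smooth immersion `x : M → ℝ³`, oriented by the Gauss map `N`, satisfies the Laplace
equation `2H = a r² + b` of stationary rotating surfaces. -/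
structure IsStationaryRotating (a b : ℝ) (x N : M → Space) : Prop where
  immersion : Manifold.IsImmersion (𝓡∂ 2) 𝓘(ℝ, Space) ∞ x
  gauss : IsGaussMap x N
  laplace : ∀ p, 2 * meanCurvature x N p = a * axisDist (x p) ^ 2 + b

/-- `Γ` is the boundary of `x : M → ℝ³`: the restriction of `x` to `∂M` is an embedding with
image `Γ`. (For an immersion `x`, this restriction is automatically an immersion of `∂M`.) -/
structure IsBoundedBy (x : M → Space) (Γ : Set Space) : Prop where
  isEmbedding : Topology.IsEmbedding (((𝓡∂ 2).boundary M).domRestrict x)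
  image_eq : x '' (𝓡∂ 2).boundary M = Γ

end Surface

end RotatingSurface

end

/-! The argument is a flux formula. Number the coordinates from 0 and put h = a r²/4 + b/2, so that
2h + r h'(r) = a r² + b. Consider on M the one-form ω = (N₀ + h x₀) dx₁ - (N₁ + h x₁) dx₀. The
N-terms of dω contribute -2H N₂ dA, because dN and dx take values in the plane orthogonal to N and
the trace of -dN is 2H. The h-terms contribute (a r² + b) dx₀ ∧ dx₁ = (a r² + b) N₂ dA. Hence the
equation 2H = a r² + b makes ω closed (`fluxField_formDensity`), and by Stokes its integral over ∂M
vanishes.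

On the boundary circle h is constant and ω = (⟨N, ν⟩ + hR) ds, where ν is the unit radial vector and
s is arc length in the direction of rotation. Since |⟨N, ν⟩| ≤ 1, the assumption |h| R > 1 gives the
coefficient the constant sign of h (`fluxForm_boundary_pos`). The boundary is connected, so its
induced orientation agrees everywhere, or nowhere, with the rotation about the axis
(`boundarySign_eq_of_mem_boundary`). The integral is then nonzero, a contradiction. Thus |h| R ≤ 1,
which is the bound divided by 4.

Stokes' theorem is obtained from the divergence theorem on the half-plane
(`integral_wedge_halfPlane`), carried to charts with a sign recording their orientation relative to
N (`chartIntegral_formDensity`), and summed with a partition of unity (`sum_chartIntegral_eq_zero`).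
-/

namespace RotatingSurface

/-! ### Triple products and the trace of the shape operator -/

/-- The triple product of three vectors of three-space. -/
def det3 (a b c : Space) : ℝ :=
  a 0 * (b 1 * c 2 - b 2 * c 1) - a 1 * (b 0 * c 2 - b 2 * c 0) + a 2 * (b 0 * c 1 - b 1 * c 0)

lemma inner_eq_sum (v w : Space) : inner ℝ v w = v 0 * w 0 + v 1 * w 1 + v 2 * w 2 := by
  simp [PiLp.inner_apply, Fin.sum_univ_three, mul_comm]

lemma sum_sq_eq_one {n : Space} (hn : ‖n‖ = 1) : n 0 ^ 2 + n 1 ^ 2 + n 2 ^ 2 = 1 := by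
  have h := real_inner_self_eq_norm_sq n
  rw [hn, inner_eq_sum] at h
  linarith

/-- For vectors orthogonal to the unit vector `n`, the cross product is the triple product with `n`
times `n`. -/
lemma cross_eq_det3_mul {v w n : Space} (hn : ‖n‖ = 1) (hv : inner ℝ v n = 0)
    (hw : inner ℝ w n = 0) :
    v 1 * w 2 - v 2 * w 1 = det3 v w n * n 0 ∧ v 2 * w 0 - v 0 * w 2 = det3 v w n * n 1 ∧
      v 0 * w 1 - v 1 * w 0 = det3 v w n * n 2 := by
  have h1 := sum_sq_eq_one hn
  rw [inner_eq_sum] at hv hw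
  unfold det3
  refine ⟨?_, ?_, ?_⟩
  · linear_combination (-(v 1 * w 2 - v 2 * w 1)) * h1 + (w 2 * n 1 - w 1 * n 2) * hv
      - (v 2 * n 1 - v 1 * n 2) * hw
  · linear_combination (-(v 2 * w 0 - v 0 * w 2)) * h1 + (w 0 * n 2 - w 2 * n 0) * hv
      - (v 0 * n 2 - v 2 * n 0) * hw
  · linear_combination (-(v 0 * w 1 - v 1 * w 0)) * h1 + (w 1 * n 0 - w 0 * n 1) * hv
      - (v 1 * n 0 - v 0 * n 1) * hw

/-- Lagrange's identity: the Gram determinant is |v × w|², and v × w is `det3 v w n` times a unit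
vector. -/
lemma gram_det_eq_det3_sq {v w n : Space} (hn : ‖n‖ = 1) (hv : inner ℝ v n = 0)
    (hw : inner ℝ w n = 0) :
    inner ℝ v v * inner ℝ w w - inner ℝ v w * inner ℝ v w = det3 v w n ^ 2 := by
  obtain ⟨h0, h1, h2⟩ := cross_eq_det3_mul hn hv hw
  have h3 := sum_sq_eq_one hn
  simp only [inner_eq_sum]
  generalize det3 v w n = d at *
  linear_combination (v 1 * w 2 - v 2 * w 1 + d * n 0) * h0 + (v 2 * w 0 - v 0 * w 2 + d * n 1) * h1
    + (v 0 * w 1 - v 1 * w 0 + d * n 2) * h2 + d ^ 2 * h3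

lemma det3_ne_zero {v w n : Space} (hn : ‖n‖ = 1) (hv : inner ℝ v n = 0)
    (hw : inner ℝ w n = 0) (hli : ∀ s t : ℝ, s • v + t • w = 0 → s = 0 ∧ t = 0) :
    det3 v w n ≠ 0 := by
  intro hd
  have hg := gram_det_eq_det3_sq hn hv hw
  rw [hd] at hg
  -- The squared norm of this combination is |w|² times the Gram determinant, hence zero.
  -- Independence then gives w = 0, which is itself a dependence.
  have key : inner ℝ w w • v + (-inner ℝ v w) • w = 0 := by
    rw [← inner_self_eq_zero (𝕜 := ℝ)]
    simp only [inner_add_left, inner_add_right, inner_smul_left, inner_smul_right,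
      real_inner_comm v w, conj_trivial]
    linear_combination (inner ℝ w w) * hg
  have hw0 := (hli _ _ key).1
  rw [inner_self_eq_zero] at hw0
  simpa using (hli 0 1 (by simp [hw0])).2

/-- The trace of the shape operator in terms of triple products. -/
lemma trace_mul_det3 {A₀ A₁ B₀ B₁ n : Space} (hn : ‖n‖ = 1) (hA₀ : inner ℝ A₀ n = 0)
    (hA₁ : inner ℝ A₁ n = 0) (hB₀ : inner ℝ B₀ n = 0) (hB₁ : inner ℝ B₁ n = 0)
    (hd : det3 B₀ B₁ n ≠ 0) (G S : Matrix (Fin 2) (Fin 2) ℝ)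
    (hG : G = !![inner ℝ B₀ B₀, inner ℝ B₀ B₁; inner ℝ B₁ B₀, inner ℝ B₁ B₁])
    (hS : S = !![-inner ℝ A₀ B₀, -inner ℝ A₀ B₁; -inner ℝ A₁ B₀, -inner ℝ A₁ B₁]) :
    (G⁻¹ * S).trace * det3 B₀ B₁ n = -(det3 A₀ B₁ n + det3 B₀ A₁ n) := by
  have hg := gram_det_eq_det3_sq hn hB₀ hB₁
  have hdet : G.det = det3 B₀ B₁ n ^ 2 := by
    rw [← hg, hG, Matrix.det_fin_two_of, real_inner_comm B₀ B₁]
  have h1 := sum_sq_eq_one hn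
  have hI : (G⁻¹ * S).trace * det3 B₀ B₁ n ^ 2 = -(inner ℝ B₁ B₁ * inner ℝ A₀ B₀
      + inner ℝ B₀ B₀ * inner ℝ A₁ B₁ - inner ℝ B₀ B₁ * (inner ℝ A₀ B₁ + inner ℝ A₁ B₀)) := by
    rw [Matrix.inv_def, hdet, hG, hS, Matrix.adjugate_fin_two_of, Ring.inverse_eq_inv']
    simp only [Matrix.smul_of, Matrix.smul_cons, Matrix.trace_fin_two, Matrix.mul_apply,
      Fin.sum_univ_two, Matrix.of_apply, Matrix.cons_val', Matrix.cons_val_zero,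
      Matrix.cons_val_one, smul_eq_mul, Matrix.smul_empty, Matrix.cons_val_fin_one]
    rw [real_inner_comm B₀ B₁]
    field_simp
    ring
  obtain ⟨b0, b1, b2⟩ := cross_eq_det3_mul hn hB₀ hB₁
  obtain ⟨p0, p1, p2⟩ := cross_eq_det3_mul hn hA₀ hB₁
  obtain ⟨q0, q1, q2⟩ := cross_eq_det3_mul hn hB₀ hA₁
  have hII : (det3 A₀ B₁ n + det3 B₀ A₁ n) * det3 B₀ B₁ n = inner ℝ B₁ B₁ * inner ℝ A₀ B₀
      + inner ℝ B₀ B₀ * inner ℝ A₁ B₁ - inner ℝ B₀ B₁ * (inner ℝ A₀ B₁ + inner ℝ A₁ B₀) := by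
    -- Since |n| = 1, a product of triple products is the inner product of the corresponding
    -- multiples of n, that is, of cross products. The Binet–Cauchy identity then expands it into
    -- inner products.
    have e : ∀ d e f : ℝ, (d + e) * f = (d * n 0 + e * n 0) * (f * n 0)
        + (d * n 1 + e * n 1) * (f * n 1) + (d * n 2 + e * n 2) * (f * n 2) := by
      intro d e f
      linear_combination (-(d + e) * f) * h1
    rw [e, ← b0, ← b1, ← b2, ← p0, ← p1, ← p2, ← q0, ← q1, ← q2]
    simp only [inner_eq_sum]
    ring
  apply mul_right_cancel₀ hd
  linear_combination hI + hII

/-! ### Linear algebra of the coordinate plane -/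

/-- The wedge product of two linear forms on the plane, evaluated at the standard basis. -/
noncomputable def wedge (A B : EuclideanSpace ℝ (Fin 2) →L[ℝ] ℝ) : ℝ :=
  A (coordVec 0) * B (coordVec 1) - A (coordVec 1) * B (coordVec 0)

lemma apply_eq_sum {V : Type*} [NormedAddCommGroup V] [NormedSpace ℝ V]
    (L : EuclideanSpace ℝ (Fin 2) →L[ℝ] V) (v : EuclideanSpace ℝ (Fin 2)) :
    L v = v 0 • L (coordVec 0) + v 1 • L (coordVec 1) := by
  have h : v = v 0 • coordVec 0 + v 1 • coordVec 1 := by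
    ext i
    fin_cases i <;> simp [coordVec]
  conv_lhs => rw [h]
  simp

lemma det_eq (T : EuclideanSpace ℝ (Fin 2) →L[ℝ] EuclideanSpace ℝ (Fin 2)) :
    T.det = T (coordVec 0) 0 * T (coordVec 1) 1 - T (coordVec 1) 0 * T (coordVec 0) 1 := by
  rw [ContinuousLinearMap.det, ← LinearMap.det_toMatrix (EuclideanSpace.basisFun (Fin 2) ℝ).toBasis,
    Matrix.det_fin_two]
  simp [LinearMap.toMatrix_apply, coordVec]

lemma wedge_comp (A B : EuclideanSpace ℝ (Fin 2) →L[ℝ] ℝ)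
    (T : EuclideanSpace ℝ (Fin 2) →L[ℝ] EuclideanSpace ℝ (Fin 2)) :
    wedge (A.comp T) (B.comp T) = T.det * wedge A B := by
  simp only [wedge, ContinuousLinearMap.comp_apply, det_eq]
  simp only [apply_eq_sum A (T _), apply_eq_sum B (T _), smul_eq_mul]
  ring

/-- The symmetrised expression is alternating in the two plane vectors, so a change of basis
multiplies it by the determinant; a single summand would not be alternating. The case A = B is
`det3_comp`. -/
lemma det3_comp_add (A B : EuclideanSpace ℝ (Fin 2) →L[ℝ] Space) (n : Space)
    (T : EuclideanSpace ℝ (Fin 2) →L[ℝ] EuclideanSpace ℝ (Fin 2)) :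
    det3 (A (T (coordVec 0))) (B (T (coordVec 1))) n
        + det3 (B (T (coordVec 0))) (A (T (coordVec 1))) n
      = T.det * (det3 (A (coordVec 0)) (B (coordVec 1)) n
        + det3 (B (coordVec 0)) (A (coordVec 1)) n) := by
  simp only [det_eq]
  simp only [apply_eq_sum A (T _), apply_eq_sum B (T _), det3, PiLp.add_apply, PiLp.smul_apply,
    smul_eq_mul]
  ring

lemma det3_comp (B : EuclideanSpace ℝ (Fin 2) →L[ℝ] Space) (n : Space)
    (T : EuclideanSpace ℝ (Fin 2) →L[ℝ] EuclideanSpace ℝ (Fin 2)) :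
    det3 (B (T (coordVec 0))) (B (T (coordVec 1))) n
      = T.det * det3 (B (coordVec 0)) (B (coordVec 1)) n := by
  linarith [det3_comp_add B B n T]

/-! ### Stokes' theorem on the half-plane -/

open MeasureTheory Set Filter Topology

/-- The identification of `ℝ × ℝ` with the Euclidean plane. -/
noncomputable def planeEquiv : (ℝ × ℝ) ≃L[ℝ] EuclideanSpace ℝ (Fin 2) :=
  (ContinuousLinearEquiv.finTwoArrow ℝ ℝ).symm.trans
    (PiLp.continuousLinearEquiv 2 ℝ (fun _ : Fin 2 => ℝ)).symm

lemma planeEquiv_apply (x : ℝ × ℝ) : planeEquiv x = !₂[x.1, x.2] := rfl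

lemma planeEquiv_zero (x : ℝ × ℝ) : planeEquiv x 0 = x.1 := by simp [planeEquiv_apply]

lemma planeEquiv_one (x : ℝ × ℝ) : planeEquiv x 1 = x.2 := by simp [planeEquiv_apply]

lemma planeEquiv_one_zero : planeEquiv (1, 0) = coordVec 0 := by
  ext i; fin_cases i <;> simp [planeEquiv_apply, coordVec]

lemma planeEquiv_zero_one : planeEquiv (0, 1) = coordVec 1 := by
  ext i; fin_cases i <;> simp [planeEquiv_apply, coordVec]

lemma measurePreserving_planeEquiv : MeasurePreserving planeEquiv :=
  (PiLp.volume_preserving_toLp (Fin 2)).comp ((volume_preserving_finTwoArrow ℝ).symm _)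

lemma integral_planeEquiv (h : EuclideanSpace ℝ (Fin 2) → ℝ) :
    ∫ x, h (planeEquiv x) = ∫ u, h u :=
  measurePreserving_planeEquiv.integral_comp
    planeEquiv.toHomeomorph.measurableEmbedding h

/-- The divergence theorem on the half-plane, for a compactly supported vector field. -/
lemma integral_divergence_halfPlane {K : Set (EuclideanSpace ℝ (Fin 2))} (hK : IsCompact K)
    (hKH : K ⊆ {u | 0 ≤ u 0}) {P Q h : EuclideanSpace ℝ (Fin 2) → ℝ}
    (hP : ContinuousOn P {u | 0 ≤ u 0}) (hQ : ContinuousOn Q {u | 0 ≤ u 0})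
    (hh : ContinuousOn h {u | 0 ≤ u 0})
    (hPK : ∀ u ∉ K, P u = 0) (hQK : ∀ u ∉ K, Q u = 0) (hhK : ∀ u ∉ K, h u = 0)
    (hd : ∀ u, 0 < u 0 → ∃ P' Q' : EuclideanSpace ℝ (Fin 2) →L[ℝ] ℝ, HasFDerivAt P P' u ∧
      HasFDerivAt Q Q' u ∧ P' (coordVec 0) - Q' (coordVec 1) = h u) :
    ∫ u, h u = -∫ t : ℝ, P !₂[0, t] := by
  -- The strict bound makes the fields vanish on three sides of the rectangle [0, L] × [-L, L]; only
  -- the side on the boundary line contributes.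
  obtain ⟨L, hL0, hL⟩ : ∃ L : ℝ, 0 < L ∧ ∀ u ∈ K, ∀ i, |u i| < L := by
    obtain ⟨C, hC⟩ := hK.isBounded.exists_norm_le
    refine ⟨|C| + 1, by positivity, fun u hu i => ?_⟩
    have h1 := PiLp.norm_apply_le u i
    rw [Real.norm_eq_abs] at h1
    linarith [hC u hu, le_abs_self C]
  have hmem : ∀ x : ℝ × ℝ, planeEquiv x ∈ K → 0 ≤ x.1 ∧ x.1 < L ∧ -L < x.2 ∧ x.2 < L := by
    intro x hx
    have h0 := hL _ hx 0
    have h1 := hL _ hx 1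
    have h2 : 0 ≤ planeEquiv x 0 := hKH hx
    rw [planeEquiv_zero] at h0 h2
    rw [planeEquiv_one] at h1
    exact ⟨h2, (abs_lt.1 h0).2, (abs_lt.1 h1).1, (abs_lt.1 h1).2⟩
  have hmaps : MapsTo planeEquiv (Icc ((0 : ℝ), -L) (L, L)) {u | 0 ≤ u 0} := by
    intro x hx
    change 0 ≤ planeEquiv x 0
    rw [planeEquiv_zero]
    exact hx.1.1
  have hcont : ∀ f : EuclideanSpace ℝ (Fin 2) → ℝ, ContinuousOn f {u | 0 ≤ u 0} →
      ContinuousOn (fun x => f (planeEquiv x)) (Icc ((0 : ℝ), -L) (L, L)) :=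
    fun f hf => hf.comp planeEquiv.continuous.continuousOn hmaps
  -- The divergence must equal h at every point, also where no derivative is available; there F is
  -- an arbitrary functional with the right value and G is 0.
  have hD : ∀ x : ℝ × ℝ, ∃ F G : ℝ × ℝ →L[ℝ] ℝ, F (1, 0) + G (0, 1) = h (planeEquiv x) ∧
      (0 < x.1 → HasFDerivAt (fun x => P (planeEquiv x)) F x ∧
        HasFDerivAt (fun x => -Q (planeEquiv x)) G x) := by
    intro x
    by_cases hx : 0 < x.1
    · obtain ⟨P', Q', h1, h2, h3⟩ := hd (planeEquiv x) (by rwa [planeEquiv_zero])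
      refine ⟨P'.comp (planeEquiv : (ℝ × ℝ) →L[ℝ] _), -(Q'.comp (planeEquiv : (ℝ × ℝ) →L[ℝ] _)),
        ?_, fun _ => ⟨h1.comp x planeEquiv.hasFDerivAt, (h2.comp x planeEquiv.hasFDerivAt).neg⟩⟩
      simp only [ContinuousLinearMap.comp_apply, neg_apply,
        ContinuousLinearEquiv.coe_coe, planeEquiv_one_zero, planeEquiv_zero_one]
      linarith
    · exact ⟨h (planeEquiv x) • ContinuousLinearMap.fst ℝ ℝ ℝ, 0, by simp, fun h => absurd h hx⟩
  choose F G hFG hder using hD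
  have hdiv := integral_divergence_prod_Icc_of_hasFDerivAt_of_le
    (fun x => P (planeEquiv x)) (fun x => -Q (planeEquiv x)) F G ((0 : ℝ), -L) (L, L)
    ⟨hL0.le, by simp; linarith⟩ (hcont P hP) (hcont Q hQ).neg
    (fun x hx => (hder x hx.1.1).1) (fun x hx => (hder x hx.1.1).2)
    (by simp only [hFG]; exact (hcont h hh).integrableOn_compact isCompact_Icc)
  simp only [hFG] at hdiv
  have hIcc : ∫ x in Icc ((0 : ℝ), -L) (L, L), h (planeEquiv x) = ∫ u, h u := by
    rw [← integral_planeEquiv]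
    refine setIntegral_eq_integral_of_forall_compl_eq_zero fun x hx => hhK _ fun hxK => hx ?_
    obtain ⟨h1, h2, h3, h4⟩ := hmem x hxK
    exact ⟨⟨h1, h3.le⟩, ⟨h2.le, h4.le⟩⟩
  have hQL : ∀ s, Q (planeEquiv (s, L)) = 0 := fun s => hQK _ fun h => (hmem _ h).2.2.2.false
  have hQL' : ∀ s, Q (planeEquiv (s, -L)) = 0 := fun s => hQK _ fun h => (hmem _ h).2.2.1.false
  have hPL : ∀ s, P (planeEquiv (L, s)) = 0 := fun s => hPK _ fun h => (hmem _ h).2.1.false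
  rw [hIcc] at hdiv
  simp only [hQL, hQL', hPL] at hdiv
  have hP0 : ∫ y in -L..L, P (planeEquiv (0, y)) = ∫ t : ℝ, P !₂[0, t] := by
    rw [intervalIntegral.integral_of_le (by linarith)]
    refine setIntegral_eq_integral_of_forall_compl_eq_zero fun t ht => hPK _ fun htK => ht ?_
    obtain ⟨-, -, h3, h4⟩ := hmem (0, t) htK
    exact ⟨h3, h4.le⟩
  rw [hdiv, hP0]
  simp

lemma indicator_eq_zero_of_notMem {X : Type*} {U K : Set X} {f : X → ℝ}
    (hfK : ∀ u ∈ U, u ∉ K → f u = 0) (u : X) (hu : u ∉ K) : U.indicator f u = 0 := by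
  by_cases h : u ∈ U
  · rw [indicator_of_mem h, hfK u h hu]
  · exact indicator_of_notMem h _

/-- Extension by zero of a function that vanishes off a compact subset of a relatively open set. -/
lemma continuousOn_indicator_of_eq_zero {X : Type*} [TopologicalSpace X] [T2Space X]
    {H U O K : Set X} (hO : IsOpen O) (hU : U = O ∩ H) (hK : IsCompact K) (hKU : K ⊆ U) {f : X → ℝ}
    (hf : ContinuousOn f U) (hfK : ∀ u ∈ U, u ∉ K → f u = 0) :
    ContinuousOn (U.indicator f) H := by
  intro u hu
  by_cases huO : u ∈ O
  · have h1 : ContinuousWithinAt f H u := by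
      have := hf u (hU ▸ ⟨huO, hu⟩)
      rw [hU, inter_comm] at this
      exact this.mono_of_mem_nhdsWithin (inter_mem self_mem_nhdsWithin
        (mem_nhdsWithin_of_mem_nhds (hO.mem_nhds huO)))
    refine h1.congr_of_eventuallyEq ?_ (indicator_of_mem (hU ▸ ⟨huO, hu⟩) _)
    filter_upwards [self_mem_nhdsWithin, mem_nhdsWithin_of_mem_nhds (hO.mem_nhds huO)] with v h1 h2
    exact indicator_of_mem (hU ▸ ⟨h2, h1⟩) _
  · have huK : u ∉ K := fun h => huO (hU ▸ hKU h : u ∈ O ∩ H).1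
    refine ContinuousAt.continuousWithinAt ?_
    refine (continuousAt_const (y := (0 : ℝ))).congr ?_
    filter_upwards [hK.isClosed.isOpen_compl.mem_nhds huK] with v hv
    exact (indicator_eq_zero_of_notMem hfK v hv).symm

lemma range_halfPlane : range (𝓡∂ 2) = {u : EuclideanSpace ℝ (Fin 2) | 0 ≤ u 0} :=
  range_euclideanHalfSpace 2

lemma range_mem_nhds {u : EuclideanSpace ℝ (Fin 2)} (hu : 0 < u 0) : range (𝓡∂ 2) ∈ 𝓝 u := by
  rw [range_halfPlane]
  have h : IsOpen {u : EuclideanSpace ℝ (Fin 2) | 0 < u 0} :=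
    isOpen_lt continuous_const (by fun_prop)
  exact mem_of_superset (h.mem_nhds hu) fun v hv => le_of_lt (α := ℝ) hv

lemma continuousOn_fderivWithin_apply {U O : Set (EuclideanSpace ℝ (Fin 2))} (hO : IsOpen O)
    (hU : U = O ∩ range (𝓡∂ 2)) {V : Type*} [NormedAddCommGroup V] [NormedSpace ℝ V]
    {f : EuclideanSpace ℝ (Fin 2) → V} (hf : ContDiffOn ℝ ∞ f U) (v : EuclideanSpace ℝ (Fin 2)) :
    ContinuousOn (fun u => fderivWithin ℝ f (range (𝓡∂ 2)) u v) U := by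
  have hUD : UniqueDiffOn ℝ U := by
    rw [hU, inter_comm]; exact (𝓡∂ 2).uniqueDiffOn.inter hO
  refine ((hf.continuousOn_fderivWithin hUD (by simp)).clm_apply
    (continuousOn_const (c := v))).congr ?_
  intro u hu
  simp only
  rw [hU] at hu ⊢
  rw [inter_comm, fderivWithin_inter (hO.mem_nhds hu.1)]

lemma fderivWithin_eq_zero_of_notMem {U O K : Set (EuclideanSpace ℝ (Fin 2))} (hO : IsOpen O)
    (hU : U = O ∩ range (𝓡∂ 2)) (hK : IsCompact K) {f : EuclideanSpace ℝ (Fin 2) → ℝ}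
    (hfK : ∀ u ∈ U, u ∉ K → f u = 0) {u : EuclideanSpace ℝ (Fin 2)} (hu : u ∈ U) (huK : u ∉ K) :
    fderivWithin ℝ f (range (𝓡∂ 2)) u = 0 := by
  have : f =ᶠ[𝓝[range (𝓡∂ 2)] u] fun _ => 0 := by
    filter_upwards [self_mem_nhdsWithin, mem_nhdsWithin_of_mem_nhds
      (hO.mem_nhds (hU ▸ hu : u ∈ O ∩ range (𝓡∂ 2)).1),
      mem_nhdsWithin_of_mem_nhds (hK.isClosed.isOpen_compl.mem_nhds huK)] with v h1 h2 h3
    exact hfK v (hU ▸ ⟨h2, h1⟩) h3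
  rw [this.fderivWithin_eq (hfK u hu huK)]
  simp

/-- **Stokes' theorem** for `f dg` on a relatively open subset of the half-plane, where `f` has
compact support. -/
lemma integral_wedge_halfPlane {U O K : Set (EuclideanSpace ℝ (Fin 2))} (hO : IsOpen O)
    (hU : U = O ∩ range (𝓡∂ 2)) (hK : IsCompact K) (hKU : K ⊆ U)
    {f g : EuclideanSpace ℝ (Fin 2) → ℝ} (hf : ContDiffOn ℝ ∞ f U) (hg : ContDiffOn ℝ ∞ g U)
    (hfK : ∀ u ∈ U, u ∉ K → f u = 0) :
    ∫ u in U, wedge (fderivWithin ℝ f (range (𝓡∂ 2)) u) (fderivWithin ℝ g (range (𝓡∂ 2)) u)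
      = -∫ t : ℝ, U.indicator
        (fun u => f u * fderivWithin ℝ g (range (𝓡∂ 2)) u (coordVec 1)) !₂[0, t] := by
  have hUm : MeasurableSet U := by
    rw [hU]; exact hO.measurableSet.inter (𝓡∂ 2).isClosed_range.measurableSet
  have hf' := fun u hu huK => fderivWithin_eq_zero_of_notMem hO hU hK hfK (u := u) hu huK
  rw [← integral_indicator hUm]
  have hPK : ∀ i, ∀ u ∈ U, u ∉ K → f u * fderivWithin ℝ g (range (𝓡∂ 2)) u (coordVec i) = 0 :=
    fun i u hu huK => by rw [hfK u hu huK, zero_mul]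
  have hhK : ∀ u ∈ U, u ∉ K → wedge (fderivWithin ℝ f (range (𝓡∂ 2)) u)
      (fderivWithin ℝ g (range (𝓡∂ 2)) u) = 0 := by
    intro u hu huK
    rw [hf' u hu huK]
    simp [wedge]
  have hcd := fun i => continuousOn_fderivWithin_apply hO hU hf (coordVec i)
  have hcg := fun i => continuousOn_fderivWithin_apply hO hU hg (coordVec i)
  -- With P = f ∂₁g and Q = f ∂₀g, the difference ∂₀P - ∂₁Q is df ∧ dg, because the second
  -- derivatives of g cancel by symmetry.
  refine integral_divergence_halfPlane (K := K)
    (Q := U.indicator fun u => f u * fderivWithin ℝ g (range (𝓡∂ 2)) u (coordVec 0)) hK ?_ ?_ ?_ ?_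
    (indicator_eq_zero_of_notMem (hPK 1)) (indicator_eq_zero_of_notMem (hPK 0))
    (indicator_eq_zero_of_notMem hhK) ?_
  · rw [← range_halfPlane]
    exact hKU.trans (hU ▸ inter_subset_right)
  · rw [← range_halfPlane]
    exact continuousOn_indicator_of_eq_zero hO hU hK hKU (hf.continuousOn.mul (hcg 1)) (hPK 1)
  · rw [← range_halfPlane]
    exact continuousOn_indicator_of_eq_zero hO hU hK hKU (hf.continuousOn.mul (hcg 0)) (hPK 0)
  · rw [← range_halfPlane]
    exact continuousOn_indicator_of_eq_zero hO hU hK hKU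
      (((hcd 0).mul (hcg 1)).sub ((hcd 1).mul (hcg 0))) hhK
  · intro u hu
    by_cases huU : u ∈ U
    · have hUn : U ∈ 𝓝 u := by
        rw [hU] at huU ⊢
        exact inter_mem (hO.mem_nhds huU.1) (range_mem_nhds hu)
      have hfu : ContDiffAt ℝ ∞ f u := hf.contDiffAt hUn
      have hgu : ContDiffAt ℝ ∞ g u := hg.contDiffAt hUn
      have hg1 : ∀ i, HasFDerivAt (fun v => fderiv ℝ g v (coordVec i))
          ((fderiv ℝ (fderiv ℝ g) u).flip (coordVec i)) u := fun i => by
        have h2 : DifferentiableAt ℝ (fderiv ℝ g) u :=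
          (hgu.fderiv_right (m := 1) (WithTop.coe_le_coe.2 le_top)).differentiableAt (by simp)
        have := h2.hasFDerivAt.clm_apply (hasFDerivAt_const (coordVec i) u)
        simpa using this
      have hev : ∀ i, U.indicator (fun u => f u * fderivWithin ℝ g (range (𝓡∂ 2)) u (coordVec i))
          =ᶠ[𝓝 u] fun v => f v * fderiv ℝ g v (coordVec i) := by
        intro i
        have hpos : IsOpen {u : EuclideanSpace ℝ (Fin 2) | 0 < u 0} :=
          isOpen_lt continuous_const (by fun_prop)
        filter_upwards [hUn, hpos.mem_nhds hu] with v h1 h2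
        rw [indicator_of_mem h1, fderivWithin_of_mem_nhds (range_mem_nhds h2)]
      have hfd := (hfu.differentiableAt (by simp)).hasFDerivAt
      refine ⟨_, _, (hfd.mul (hg1 1)).congr_of_eventuallyEq (hev 1),
        (hfd.mul (hg1 0)).congr_of_eventuallyEq (hev 0), ?_⟩
      have hsymm : fderiv ℝ (fderiv ℝ g) u (coordVec 0) (coordVec 1)
          = fderiv ℝ (fderiv ℝ g) u (coordVec 1) (coordVec 0) :=
        (hgu.isSymmSndFDerivAt (by
            rw [minSmoothness_of_isRCLikeNormedField]
            exact WithTop.coe_le_coe.2 le_top)) _ _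
      rw [indicator_of_mem huU, fderivWithin_of_mem_nhds (range_mem_nhds hu),
        fderivWithin_of_mem_nhds (range_mem_nhds hu)]
      simp only [wedge, add_apply, smul_apply,
        ContinuousLinearMap.flip_apply, smul_eq_mul, hsymm]
      ring
    · have huK : u ∉ K := fun h => huU (hKU h)
      have hz : ∀ i, U.indicator (fun u => f u * fderivWithin ℝ g (range (𝓡∂ 2)) u (coordVec i))
          =ᶠ[𝓝 u] fun _ => 0 := by
        intro i
        filter_upwards [hK.isClosed.isOpen_compl.mem_nhds huK] with v hv
        exact indicator_eq_zero_of_notMem (hPK i) v hv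
      refine ⟨0, 0, (hasFDerivAt_const 0 u).congr_of_eventuallyEq (hz 1),
        (hasFDerivAt_const 0 u).congr_of_eventuallyEq (hz 0), ?_⟩
      rw [indicator_of_notMem huU]
      simp

/-! ### Derivatives in charts and transition maps -/

section Coordinates

variable {M : Type*} [TopologicalSpace M] [ChartedSpace (EuclideanHalfSpace 2) M]
  {V : Type*} [NormedAddCommGroup V] [NormedSpace ℝ V]

/-- The derivative of `f` in the chart at `q`, at the coordinates `u`. -/
noncomputable def coordDeriv (q : M) (f : M → V) (u : EuclideanSpace ℝ (Fin 2)) :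
    EuclideanSpace ℝ (Fin 2) →L[ℝ] V :=
  fderivWithin ℝ (f ∘ (extChartAt (𝓡∂ 2) q).symm) (range (𝓡∂ 2)) u

lemma exists_isOpen_target_eq (q : M) : ∃ O : Set (EuclideanSpace ℝ (Fin 2)), IsOpen O ∧
    (extChartAt (𝓡∂ 2) q).target = O ∩ range (𝓡∂ 2) :=
  ⟨_, (chartAt (EuclideanHalfSpace 2) q).open_target.preimage (𝓡∂ 2).continuous_symm,
    extChartAt_target (I := 𝓡∂ 2) q⟩

lemma measurableSet_target (q : M) : MeasurableSet (extChartAt (𝓡∂ 2) q).target := by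
  obtain ⟨O, hO, h⟩ := exists_isOpen_target_eq q
  rw [h]
  exact hO.measurableSet.inter (𝓡∂ 2).isClosed_range.measurableSet

lemma differential_eq_coordDeriv {f : M → Space} {p : M}
    (hf : MDifferentiableAt (𝓡∂ 2) 𝓘(ℝ, Space) f p) :
    differential f p = coordDeriv p f (extChartAt (𝓡∂ 2) p p) := by
  exact if_pos hf

lemma coordDeriv_eq_of_hasFDerivWithinAt {f : M → V} {q : M} {u : EuclideanSpace ℝ (Fin 2)}
    (hu : u ∈ (extChartAt (𝓡∂ 2) q).target) {f' : EuclideanSpace ℝ (Fin 2) →L[ℝ] V}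
    (h : HasFDerivWithinAt (f ∘ (extChartAt (𝓡∂ 2) q).symm) f' (range (𝓡∂ 2)) u) :
    coordDeriv q f u = f' :=
  h.fderivWithin ((𝓡∂ 2).uniqueDiffOn u (extChartAt_target_subset_range q hu))

lemma contMDiff_coord {f : M → Space} (hf : ContMDiff (𝓡∂ 2) 𝓘(ℝ, Space) ∞ f) (i : Fin 3) :
    ContMDiff (𝓡∂ 2) 𝓘(ℝ, ℝ) ∞ fun p => f p i :=
  (EuclideanSpace.proj i : Space →L[ℝ] ℝ).contMDiff.comp hf

variable [IsManifold (𝓡∂ 2) ∞ M]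

lemma contDiffOn_comp_extChartAt_symm {f : M → V} (hf : ContMDiff (𝓡∂ 2) 𝓘(ℝ, V) ∞ f) (q : M) :
    ContDiffOn ℝ ∞ (f ∘ (extChartAt (𝓡∂ 2) q).symm) (extChartAt (𝓡∂ 2) q).target :=
  contMDiffOn_iff_contDiffOn.1 (hf.comp_contMDiffOn (contMDiffOn_extChartAt_symm q))

lemma differentiableWithinAt_comp_extChartAt_symm {f : M → V}
    (hf : ContMDiff (𝓡∂ 2) 𝓘(ℝ, V) ∞ f) (q : M) {u : EuclideanSpace ℝ (Fin 2)}
    (hu : u ∈ (extChartAt (𝓡∂ 2) q).target) :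
    DifferentiableWithinAt ℝ (f ∘ (extChartAt (𝓡∂ 2) q).symm) (range (𝓡∂ 2)) u :=
  ((contDiffOn_comp_extChartAt_symm hf q).differentiableOn (by simp) u hu).mono_of_mem_nhdsWithin
    (extChartAt_target_mem_nhdsWithin_of_mem hu)

lemma hasFDerivWithinAt_coordDeriv {f : M → V} (hf : ContMDiff (𝓡∂ 2) 𝓘(ℝ, V) ∞ f) (q : M)
    {u : EuclideanSpace ℝ (Fin 2)} (hu : u ∈ (extChartAt (𝓡∂ 2) q).target) :
    HasFDerivWithinAt (f ∘ (extChartAt (𝓡∂ 2) q).symm) (coordDeriv q f u) (range (𝓡∂ 2)) u :=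
  (differentiableWithinAt_comp_extChartAt_symm hf q hu).hasFDerivWithinAt

/-- The transition map between two charts is differentiable. -/
lemma hasFDerivWithinAt_transition {q q' : M} {u : EuclideanSpace ℝ (Fin 2)}
    (hu : u ∈ (extChartAt (𝓡∂ 2) q).target)
    (hu' : (extChartAt (𝓡∂ 2) q).symm u ∈ (extChartAt (𝓡∂ 2) q').source) :
    HasFDerivWithinAt (extChartAt (𝓡∂ 2) q' ∘ (extChartAt (𝓡∂ 2) q).symm)
      (coordDeriv q (extChartAt (𝓡∂ 2) q') u) (range (𝓡∂ 2)) u := by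
  have h := contDiffWithinAt_ext_coord_change (I := 𝓡∂ 2) (n := ∞) q' q (y := u)
    (by simp only [PartialEquiv.trans_source, PartialEquiv.symm_source]; exact ⟨hu, hu'⟩)
  exact (h.differentiableWithinAt (by simp)).hasFDerivWithinAt

/-- Change of coordinates for derivatives. -/
lemma coordDeriv_eq_comp {f : M → V} (hf : ContMDiff (𝓡∂ 2) 𝓘(ℝ, V) ∞ f) {q q' : M}
    {u : EuclideanSpace ℝ (Fin 2)} (hu : u ∈ (extChartAt (𝓡∂ 2) q).target)
    (hu' : (extChartAt (𝓡∂ 2) q).symm u ∈ (extChartAt (𝓡∂ 2) q').source) :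
    coordDeriv q f u = (coordDeriv q' f (extChartAt (𝓡∂ 2) q' ((extChartAt (𝓡∂ 2) q).symm u))).comp
      (coordDeriv q (extChartAt (𝓡∂ 2) q') u) := by
  apply coordDeriv_eq_of_hasFDerivWithinAt hu
  have h1 := (hasFDerivWithinAt_coordDeriv hf q' ((extChartAt (𝓡∂ 2) q').map_source hu')).comp
    (t := range (𝓡∂ 2)) (f := extChartAt (𝓡∂ 2) q' ∘ (extChartAt (𝓡∂ 2) q).symm) u
    (hasFDerivWithinAt_transition hu hu') (fun v _ => mem_range_self _)
  refine h1.congr_of_eventuallyEq ?_ ?_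
  · have h2 : ContinuousWithinAt (extChartAt (𝓡∂ 2) q).symm (range (𝓡∂ 2)) u :=
      (continuousAt_extChartAt_symm'' hu).continuousWithinAt
    filter_upwards [h2 ((isOpen_extChartAt_source q').mem_nhds hu')] with v hv
    exact congrArg f ((extChartAt (𝓡∂ 2) q').left_inv hv).symm
  · exact congrArg f ((extChartAt (𝓡∂ 2) q').left_inv hu').symm

lemma coordDeriv_sum {ι : Type*} (s : Finset ι) {f : ι → M → V}
    (hf : ∀ i ∈ s, ContMDiff (𝓡∂ 2) 𝓘(ℝ, V) ∞ (f i)) {q : M} {u : EuclideanSpace ℝ (Fin 2)}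
    (hu : u ∈ (extChartAt (𝓡∂ 2) q).target) :
    coordDeriv q (fun p => ∑ i ∈ s, f i p) u = ∑ i ∈ s, coordDeriv q (f i) u :=
  coordDeriv_eq_of_hasFDerivWithinAt hu
    (HasFDerivWithinAt.fun_sum fun i hi => hasFDerivWithinAt_coordDeriv (hf i hi) q hu)

lemma coordDeriv_add {f g : M → V} (hf : ContMDiff (𝓡∂ 2) 𝓘(ℝ, V) ∞ f)
    (hg : ContMDiff (𝓡∂ 2) 𝓘(ℝ, V) ∞ g) {q : M} {u : EuclideanSpace ℝ (Fin 2)}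
    (hu : u ∈ (extChartAt (𝓡∂ 2) q).target) :
    coordDeriv q (fun p => f p + g p) u = coordDeriv q f u + coordDeriv q g u :=
  coordDeriv_eq_of_hasFDerivWithinAt hu
    ((hasFDerivWithinAt_coordDeriv hf q hu).add (hasFDerivWithinAt_coordDeriv hg q hu))

lemma coordDeriv_mul {f g : M → ℝ} (hf : ContMDiff (𝓡∂ 2) 𝓘(ℝ, ℝ) ∞ f)
    (hg : ContMDiff (𝓡∂ 2) 𝓘(ℝ, ℝ) ∞ g) {q : M} {u : EuclideanSpace ℝ (Fin 2)}
    (hu : u ∈ (extChartAt (𝓡∂ 2) q).target) :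
    coordDeriv q (fun p => f p * g p) u = f ((extChartAt (𝓡∂ 2) q).symm u) • coordDeriv q g u
      + g ((extChartAt (𝓡∂ 2) q).symm u) • coordDeriv q f u :=
  coordDeriv_eq_of_hasFDerivWithinAt hu
    ((hasFDerivWithinAt_coordDeriv hf q hu).mul (hasFDerivWithinAt_coordDeriv hg q hu))

lemma coordDeriv_coord {f : M → Space} (hf : ContMDiff (𝓡∂ 2) 𝓘(ℝ, Space) ∞ f) (i : Fin 3) {q : M}
    {u : EuclideanSpace ℝ (Fin 2)} (hu : u ∈ (extChartAt (𝓡∂ 2) q).target)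
    (v : EuclideanSpace ℝ (Fin 2)) :
    coordDeriv q (fun p => f p i) u v = coordDeriv q f u v i := by
  have h : coordDeriv q (fun p => f p i) u
      = (EuclideanSpace.proj i : Space →L[ℝ] ℝ).comp (coordDeriv q f u) :=
    coordDeriv_eq_of_hasFDerivWithinAt hu
      ((EuclideanSpace.proj i : Space →L[ℝ] ℝ).hasFDerivAt.comp_hasFDerivWithinAt
        u (hasFDerivWithinAt_coordDeriv hf q hu))
  rw [h]
  rfl

/-- At a boundary point, the differential of a transition map preserves the tangent line of the
boundary and does not point outwards on an inward vector. -/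
lemma transition_boundary {q q' : M} {u : EuclideanSpace ℝ (Fin 2)}
    (hu : u ∈ (extChartAt (𝓡∂ 2) q).target)
    (hu' : (extChartAt (𝓡∂ 2) q).symm u ∈ (extChartAt (𝓡∂ 2) q').source) (h0 : u 0 = 0)
    (h0' : extChartAt (𝓡∂ 2) q' ((extChartAt (𝓡∂ 2) q).symm u) 0 = 0) :
    coordDeriv q (extChartAt (𝓡∂ 2) q') u (coordVec 1) 0 = 0 ∧
      0 ≤ coordDeriv q (extChartAt (𝓡∂ 2) q') u (coordVec 0) 0 := by
  -- The transition map takes values in the half-plane, so its zeroth coordinate is minimal where it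
  -- vanishes. Both ±`coordVec 1` are admissible directions, but only the inward `coordVec 0` is,
  -- which gives an equality and an inequality.
  have hmin : IsLocalMinOn (fun v => extChartAt (𝓡∂ 2) q' ((extChartAt (𝓡∂ 2) q).symm v) 0)
      (range (𝓡∂ 2)) u := by
    refine Eventually.of_forall fun v => ?_
    have : extChartAt (𝓡∂ 2) q' ((extChartAt (𝓡∂ 2) q).symm v) ∈ range (𝓡∂ 2) := mem_range_self _
    rw [range_halfPlane] at this
    simp only [h0']
    exact this
  have hd := (EuclideanSpace.proj 0 : EuclideanSpace ℝ (Fin 2) →L[ℝ] ℝ).hasFDerivAt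
    |>.comp_hasFDerivWithinAt u (hasFDerivWithinAt_transition hu hu')
  have hcone : ∀ v : EuclideanSpace ℝ (Fin 2), 0 ≤ v 0 → v ∈ posTangentConeAt (range (𝓡∂ 2)) u := by
    intro v hv
    apply mem_posTangentConeAt_of_segment_subset
    refine (𝓡∂ 2).convex_range.segment_subset (extChartAt_target_subset_range q hu) ?_
    rw [range_halfPlane]
    change 0 ≤ u 0 + v 0
    rwa [h0, zero_add]
  have e1 := hmin.hasFDerivWithinAt_eq_zero hd (hcone (coordVec 1) (by simp [coordVec]))
    (hcone (-coordVec 1) (by simp [coordVec]))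
  have e0 := hmin.hasFDerivWithinAt_nonneg hd (hcone (coordVec 0) (by simp [coordVec]))
  exact ⟨e1, e0⟩

/-- Whether a point is interior can be tested in any chart of the atlas, so the chart at q decides
it for all points of its domain. -/
lemma mem_boundary_iff {q : M} {u : EuclideanSpace ℝ (Fin 2)}
    (hu : u ∈ (extChartAt (𝓡∂ 2) q).target) :
    (extChartAt (𝓡∂ 2) q).symm u ∈ (𝓡∂ 2).boundary M ↔ u 0 = 0 := by
  have hp := (extChartAt (𝓡∂ 2) q).map_target hu
  have h := (𝓡∂ 2).isInteriorPoint_iff_of_mem_atlas (n := ∞) (by simp)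
    (chart_mem_atlas (EuclideanHalfSpace 2) q) (by rwa [extChartAt_source] at hp)
  change _ ↔ extChartAt (𝓡∂ 2) q _ ∈ interior (extChartAt (𝓡∂ 2) q).target at h
  rw [(extChartAt (𝓡∂ 2) q).right_inv hu] at h
  obtain ⟨O, hO, hOt⟩ := exists_isOpen_target_eq q
  rw [hOt] at hu h
  have hu0 : 0 ≤ u 0 := (range_halfPlane ▸ hu.2 : u ∈ {u : EuclideanSpace ℝ (Fin 2) | 0 ≤ u 0})
  rw [interior_inter, hO.interior_eq, range_halfPlane, interior_halfSpace] at h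
  change (𝓡∂ 2).IsBoundaryPoint _ ↔ _
  rw [ModelWithCorners.isBoundaryPoint_iff_not_isInteriorPoint, h]
  constructor
  · intro h1
    by_contra h2
    exact h1 ⟨hu.1, lt_of_le_of_ne hu0 (Ne.symm h2)⟩
  · rintro h1 ⟨-, h2⟩
    exact (h1 ▸ h2 : (0 : ℝ) < 0).false

end Coordinates

/-! ### Area density and area integrals in charts -/

section Integration

variable {M : Type*} [TopologicalSpace M] [ChartedSpace (EuclideanHalfSpace 2) M]

lemma integrableOn_target_of_continuousOn {q : M} {K : Set M} (hK : IsCompact K)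
    (hKs : K ⊆ (extChartAt (𝓡∂ 2) q).source) {h : EuclideanSpace ℝ (Fin 2) → ℝ}
    (hh : ContinuousOn h (extChartAt (𝓡∂ 2) q).target)
    (h0 : ∀ u ∈ (extChartAt (𝓡∂ 2) q).target, (extChartAt (𝓡∂ 2) q).symm u ∉ K → h u = 0) :
    IntegrableOn h (extChartAt (𝓡∂ 2) q).target := by
  have hc : IsCompact (extChartAt (𝓡∂ 2) q '' K) :=
    hK.image_of_continuousOn ((continuousOn_extChartAt q).mono hKs)
  have hsub : extChartAt (𝓡∂ 2) q '' K ⊆ (extChartAt (𝓡∂ 2) q).target := by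
    rintro _ ⟨p, hp, rfl⟩
    exact (extChartAt (𝓡∂ 2) q).map_source (hKs hp)
  refine ((hh.mono hsub).integrableOn_compact hc).of_forall_sdiff_eq_zero
    (measurableSet_target q) fun u hu => h0 u hu.1 fun hK' => hu.2 ?_
  exact ⟨_, hK', (extChartAt (𝓡∂ 2) q).right_inv hu.1⟩

variable [IsManifold (𝓡∂ 2) ∞ M] {x N : M → Space}

/-- The differential of an immersion is injective. -/
lemma differential_injective (hx : Manifold.IsImmersion (𝓡∂ 2) 𝓘(ℝ, Space) ∞ x) (p : M) :
    Function.Injective (differential x p) := by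
  have hp := hx.isImmersionAt p
  set I := 𝓡∂ 2 with hI
  have he := hp.domChart_mem_maximalAtlas
  have hψ := hp.codChart_mem_maximalAtlas
  -- In charts adapted to the immersion, x is u ↦ (u, 0), and r reads off the first component. So r
  -- ∘ x is the adapted chart, and read in the preferred chart it is a coordinate change. The
  -- derivative of that is invertible and factors through dx.
  let r : Space → EuclideanSpace ℝ (Fin 2) := fun y => (hp.equiv.symm (hp.codChart y)).1
  have hψd : DifferentiableAt ℝ hp.codChart (x p) :=
    ((contMDiffOn_iff_contDiffOn.1 (contMDiffOn_of_mem_maximalAtlas hψ)).contDiffAt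
      (hp.codChart.open_source.mem_nhds hp.mem_codChart_source)).differentiableAt (by simp)
  have hr : DifferentiableAt ℝ r (x p) :=
    (hp.equiv.symm.differentiableAt.comp (x p) hψd).fst
  have hrx : ∀ p' ∈ hp.domChart.source, r (x p') = hp.domChart.extend I p' := by
    intro p' hp'
    have h1 : p' ∈ (hp.domChart.extend I).source := by rwa [OpenPartialHomeomorph.extend_source]
    have h2 := hp.writtenInCharts ((hp.domChart.extend I).map_source h1)
    simp only [Function.comp_apply, (hp.domChart.extend I).left_inv h1] at h2
    have h3 : hp.codChart (x p') = hp.equiv (hp.domChart.extend I p', 0) := h2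
    simp only [r, h3, ContinuousLinearEquiv.symm_apply_apply]
  have hxd := hx.contMDiff
  set C := I.extendCoordChange (chartAt (EuclideanHalfSpace 2) p) hp.domChart with hC
  have hu : extChartAt I p p ∈ C.source := by
    simp [hC, ModelWithCorners.extendCoordChange, hp.mem_domChart_source]
  have hCr : C.source ⊆ range I := by
    intro v hv
    exact extChartAt_target_subset_range p hv.1
  have hsrc : ∀ v ∈ C.source, (extChartAt I p).symm v ∈ hp.domChart.source := by
    intro v hv
    have h1 : (extChartAt I p).symm v ∈ (hp.domChart.extend I).source := hv.2
    rwa [OpenPartialHomeomorph.extend_source] at h1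
  have hinv := ModelWithCorners.isInvertible_fderivWithin_extendCoordChange (I := I) (n := ∞)
    (by simp)
    (IsManifold.chart_mem_maximalAtlas p) he hu
  rw [differential_eq_coordDeriv (hxd.mdifferentiableAt (by simp))]
  have hX := hasFDerivWithinAt_coordDeriv hxd p (mem_extChartAt_target (I := I) p)
  have hX0 : (x ∘ (extChartAt I p).symm) (extChartAt I p p) = x p := by simp
  have hcomp := ((hX0 ▸ hr).hasFDerivAt.comp_hasFDerivWithinAt _ hX).mono hCr
  have hCd := hcomp.congr (f₁ := C) (fun v hv => (hrx _ (hsrc v hv)).symm)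
    (hrx _ (hsrc _ hu)).symm
  rw [hCd.fderivWithin (ModelWithCorners.uniqueDiffOn_extendCoordChange_source _ hu)] at hinv
  have := hinv.injective
  rw [ContinuousLinearMap.coe_comp] at this
  exact this.of_comp

/-- The signed area density of the immersion in the chart at `q`. -/
noncomputable def areaDensity (x N : M → Space) (q : M) (u : EuclideanSpace ℝ (Fin 2)) : ℝ :=
  det3 (coordDeriv q x u (coordVec 0)) (coordDeriv q x u (coordVec 1))
    (N ((extChartAt (𝓡∂ 2) q).symm u))

lemma areaDensity_eq (hx : ContMDiff (𝓡∂ 2) 𝓘(ℝ, Space) ∞ x) {q q' : M}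
    {u : EuclideanSpace ℝ (Fin 2)} (hu : u ∈ (extChartAt (𝓡∂ 2) q).target)
    (hu' : (extChartAt (𝓡∂ 2) q).symm u ∈ (extChartAt (𝓡∂ 2) q').source) :
    areaDensity x N q u = (coordDeriv q (extChartAt (𝓡∂ 2) q') u).det *
      areaDensity x N q' (extChartAt (𝓡∂ 2) q' ((extChartAt (𝓡∂ 2) q).symm u)) := by
  rw [areaDensity, areaDensity, coordDeriv_eq_comp hx hu hu', (extChartAt (𝓡∂ 2) q').left_inv hu']
  exact det3_comp _ _ _

/-- In the preferred chart of the point itself the coordinate derivative is the differential, which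
is injective with image orthogonal to N. The transformation rule carries the nonvanishing over to
the chart at q. -/
lemma areaDensity_ne_zero (hx : Manifold.IsImmersion (𝓡∂ 2) 𝓘(ℝ, Space) ∞ x)
    (hN : IsGaussMap x N) {q : M} {u : EuclideanSpace ℝ (Fin 2)}
    (hu : u ∈ (extChartAt (𝓡∂ 2) q).target) : areaDensity x N q u ≠ 0 := by
  set p := (extChartAt (𝓡∂ 2) q).symm u with hp
  have hps := (extChartAt (𝓡∂ 2) q).map_target hu
  have h1 : areaDensity x N p (extChartAt (𝓡∂ 2) p p) ≠ 0 := by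
    rw [areaDensity, extChartAt_to_inv,
      ← differential_eq_coordDeriv (hx.contMDiff.mdifferentiableAt (by simp))]
    refine det3_ne_zero (hN.norm_eq_one p) (hN.orthogonal p _) (hN.orthogonal p _) ?_
    intro s t hst
    rw [← map_smul, ← map_smul, ← map_add] at hst
    have h0 := differential_injective hx p (hst.trans (map_zero _).symm)
    have e0 := congrArg (fun v : EuclideanSpace ℝ (Fin 2) => v 0) h0
    have e1 := congrArg (fun v : EuclideanSpace ℝ (Fin 2) => v 1) h0
    exact ⟨by simpa [coordVec] using e0, by simpa [coordVec] using e1⟩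
  have h2 := areaDensity_eq (N := N) hx.contMDiff (mem_extChartAt_target (I := 𝓡∂ 2) p)
    (q' := q) (by rw [extChartAt_to_inv]; exact hps)
  rw [extChartAt_to_inv, hp, (extChartAt (𝓡∂ 2) q).right_inv hu, ← hp] at h2
  intro h3
  rw [h3, mul_zero] at h2
  exact h1 h2

/-- The integral over the chart at `q` of a function with respect to the area measure. -/
noncomputable def chartIntegral (x N : M → Space) (q : M) (F : M → ℝ) : ℝ :=
  ∫ u in (extChartAt (𝓡∂ 2) q).target, F ((extChartAt (𝓡∂ 2) q).symm u) * |areaDensity x N q u|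

/-- The area integral does not depend on the chart. -/
lemma chartIntegral_congr (hx : ContMDiff (𝓡∂ 2) 𝓘(ℝ, Space) ∞ x) {q q' : M} {F : M → ℝ}
    (hF : ∀ p, F p ≠ 0 → p ∈ (extChartAt (𝓡∂ 2) q).source ∧ p ∈ (extChartAt (𝓡∂ 2) q').source) :
    chartIntegral x N q F = chartIntegral x N q' F := by
  set φ := extChartAt (𝓡∂ 2) q with hφ
  set φ' := extChartAt (𝓡∂ 2) q' with hφ'
  set s := φ.target ∩ φ.symm ⁻¹' φ'.source with hs
  have hsm : MeasurableSet s := by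
    obtain ⟨O, hO, h⟩ := continuousOn_iff'.1 (continuousOn_extChartAt_symm (I := 𝓡∂ 2) q) φ'.source
      (isOpen_extChartAt_source q')
    rw [hs, inter_comm, h]
    exact hO.measurableSet.inter (measurableSet_target q)
  have himg : (φ' ∘ φ.symm) '' s = φ'.target ∩ φ'.symm ⁻¹' φ.source := by
    ext v
    constructor
    · rintro ⟨u, ⟨hu, hu'⟩, rfl⟩
      refine ⟨φ'.map_source hu', ?_⟩
      simp only [mem_preimage, Function.comp_apply, φ'.left_inv hu']
      exact φ.map_target hu
    · rintro ⟨hv, hv'⟩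
      refine ⟨φ (φ'.symm v), ⟨φ.map_source hv', ?_⟩, ?_⟩
      · simp only [mem_preimage, φ.left_inv hv']
        exact φ'.map_target hv
      · simp only [Function.comp_apply, φ.left_inv hv', φ'.right_inv hv]
  have hinj : InjOn (φ' ∘ φ.symm) s := by
    intro u hu v hv huv
    exact φ.symm.injOn hu.1 hv.1 (φ'.injOn hu.2 hv.2 huv)
  have hder : ∀ u ∈ s, HasFDerivWithinAt (φ' ∘ φ.symm) (coordDeriv q φ' u) s u := fun u hu =>
    (hasFDerivWithinAt_transition hu.1 hu.2).mono
      (inter_subset_left.trans (extChartAt_target_subset_range q))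
  have e1 : chartIntegral x N q F = ∫ u in s, F (φ.symm u) * |areaDensity x N q u| := by
    refine setIntegral_eq_of_subset_of_forall_sdiff_eq_zero (measurableSet_target q)
      inter_subset_left fun u hu => ?_
    have : F (φ.symm u) = 0 := by
      by_contra h
      exact hu.2 ⟨hu.1, (hF _ h).2⟩
    rw [this, zero_mul]
  have e2 : chartIntegral x N q' F
      = ∫ u in (φ' ∘ φ.symm) '' s, F (φ'.symm u) * |areaDensity x N q' u| := by
    rw [himg]
    refine setIntegral_eq_of_subset_of_forall_sdiff_eq_zero (measurableSet_target q')
      inter_subset_left fun u hu => ?_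
    have : F (φ'.symm u) = 0 := by
      by_contra h
      exact hu.2 ⟨hu.1, (hF _ h).1⟩
    rw [this, zero_mul]
  rw [e1, e2, integral_image_eq_integral_abs_det_fderiv_smul volume hsm hder hinj]
  refine setIntegral_congr_fun hsm fun u hu => ?_
  simp only [Function.comp_apply, smul_eq_mul]
  rw [φ'.left_inv hu.2, areaDensity_eq hx hu.1 hu.2, abs_mul]
  ring

end Integration

/-! ### Stokes' theorem on the surface -/

section Stokes

variable {M : Type*} [TopologicalSpace M] [ChartedSpace (EuclideanHalfSpace 2) M]

/-- The two-form `df₀ ∧ dx₁ - df₁ ∧ dx₀` in the chart at `q`. -/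
noncomputable def coordForm (x : M → Space) (f₀ f₁ : M → ℝ) (q : M)
    (u : EuclideanSpace ℝ (Fin 2)) : ℝ :=
  wedge (coordDeriv q f₀ u) (coordDeriv q (fun p => x p 1) u)
    - wedge (coordDeriv q f₁ u) (coordDeriv q (fun p => x p 0) u)

/-- The density of `df₀ ∧ dx₁ - df₁ ∧ dx₀` with respect to the oriented area form. -/
noncomputable def formDensity (x N : M → Space) (f₀ f₁ : M → ℝ) (p : M) : ℝ :=
  coordForm x f₀ f₁ p (extChartAt (𝓡∂ 2) p p) / areaDensity x N p (extChartAt (𝓡∂ 2) p p)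

lemma coordDeriv_eq_zero_of_notMem_tsupport {ρ f : M → ℝ} {p : M} (hp : p ∉ tsupport ρ) :
    coordDeriv p (fun y => ρ y * f y) (extChartAt (𝓡∂ 2) p p) = 0 := by
  have h : (fun y => ρ y * f y) ∘ (extChartAt (𝓡∂ 2) p).symm
      =ᶠ[𝓝[range (𝓡∂ 2)] (extChartAt (𝓡∂ 2) p p)] fun _ => 0 := by
    have hc := (continuousAt_extChartAt_symm (I := 𝓡∂ 2) p).continuousWithinAt (s := range (𝓡∂ 2))
    have hO : (tsupport ρ)ᶜ ∈ 𝓝 ((extChartAt (𝓡∂ 2) p).symm (extChartAt (𝓡∂ 2) p p)) := by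
      rw [extChartAt_to_inv]
      exact (isClosed_tsupport ρ).isOpen_compl.mem_nhds hp
    filter_upwards [hc hO] with v hv
    simp only [Function.comp_apply, image_eq_zero_of_notMem_tsupport hv, zero_mul]
  rw [coordDeriv, h.fderivWithin_eq]
  · simp
  · simp only [Function.comp_apply, extChartAt_to_inv, image_eq_zero_of_notMem_tsupport hp,
      zero_mul]

lemma formDensity_eq_zero_of_notMem_tsupport {x N : M → Space} {ρ f₀ f₁ : M → ℝ} {p : M}
    (hp : p ∉ tsupport ρ) :
    formDensity x N (fun y => ρ y * f₀ y) (fun y => ρ y * f₁ y) p = 0 := by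
  rw [formDensity, coordForm, coordDeriv_eq_zero_of_notMem_tsupport hp,
    coordDeriv_eq_zero_of_notMem_tsupport hp]
  simp [wedge]

variable [IsManifold (𝓡∂ 2) ∞ M] {x N : M → Space}

/-- The two-form and the area form are both multiplied by the determinant of the transition map, so
their quotient, defined with a different chart at each point, can be computed in any one chart. -/
lemma formDensity_mul_areaDensity (hx : Manifold.IsImmersion (𝓡∂ 2) 𝓘(ℝ, Space) ∞ x)
    (hN : IsGaussMap x N) {f₀ f₁ : M → ℝ} (hf₀ : ContMDiff (𝓡∂ 2) 𝓘(ℝ, ℝ) ∞ f₀)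
    (hf₁ : ContMDiff (𝓡∂ 2) 𝓘(ℝ, ℝ) ∞ f₁) {q : M} {u : EuclideanSpace ℝ (Fin 2)}
    (hu : u ∈ (extChartAt (𝓡∂ 2) q).target) :
    formDensity x N f₀ f₁ ((extChartAt (𝓡∂ 2) q).symm u) * areaDensity x N q u
      = coordForm x f₀ f₁ q u := by
  set p := (extChartAt (𝓡∂ 2) q).symm u with hp
  have hps := (extChartAt (𝓡∂ 2) q).map_target hu
  have hpt := mem_extChartAt_target (I := 𝓡∂ 2) p
  have hps' : (extChartAt (𝓡∂ 2) p).symm (extChartAt (𝓡∂ 2) p p)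
      ∈ (extChartAt (𝓡∂ 2) q).source := by
    rw [extChartAt_to_inv]; exact hps
  have hqu : extChartAt (𝓡∂ 2) q ((extChartAt (𝓡∂ 2) p).symm (extChartAt (𝓡∂ 2) p p)) = u := by
    rw [extChartAt_to_inv, hp, (extChartAt (𝓡∂ 2) q).right_inv hu]
  have harea := areaDensity_eq (N := N) hx.contMDiff hpt hps'
  have hform : coordForm x f₀ f₁ p (extChartAt (𝓡∂ 2) p p)
      = (coordDeriv p (extChartAt (𝓡∂ 2) q) (extChartAt (𝓡∂ 2) p p)).det
        * coordForm x f₀ f₁ q u := by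
    rw [coordForm, coordForm, coordDeriv_eq_comp hf₀ hpt hps', coordDeriv_eq_comp hf₁ hpt hps',
      coordDeriv_eq_comp (contMDiff_coord hx.contMDiff 0) hpt hps',
      coordDeriv_eq_comp (contMDiff_coord hx.contMDiff 1) hpt hps', wedge_comp, wedge_comp, hqu]
    ring
  rw [hqu] at harea
  have h1 := areaDensity_ne_zero hx hN hpt
  rw [harea] at h1
  rw [formDensity, harea, hform]
  have h2 := left_ne_zero_of_mul h1
  have h3 := right_ne_zero_of_mul h1
  field_simp

lemma continuousOn_areaDensity (hx : ContMDiff (𝓡∂ 2) 𝓘(ℝ, Space) ∞ x)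
    (hN : ContMDiff (𝓡∂ 2) 𝓘(ℝ, Space) ∞ N) (q : M) :
    ContinuousOn (areaDensity x N q) (extChartAt (𝓡∂ 2) q).target := by
  obtain ⟨O, hO, hU⟩ := exists_isOpen_target_eq q
  have h := fun i => continuousOn_fderivWithin_apply hO hU (contDiffOn_comp_extChartAt_symm hx q)
    (coordVec i)
  have hc : ∀ {f : EuclideanSpace ℝ (Fin 2) → Space} {s : Set (EuclideanSpace ℝ (Fin 2))}
      (i : Fin 3), ContinuousOn f s → ContinuousOn (fun u => f u i) s := fun i hf =>
    (EuclideanSpace.proj i : Space →L[ℝ] ℝ).continuous.comp_continuousOn hf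
  have hn := (contDiffOn_comp_extChartAt_symm hN q).continuousOn
  have h0 := fun i => hc i (h 0)
  have h1 := fun i => hc i (h 1)
  have h2 := fun i => hc i hn
  unfold areaDensity det3
  exact ((((h0 0).mul (((h1 1).mul (h2 2)).sub ((h1 2).mul (h2 1)))).sub
    ((h0 1).mul (((h1 0).mul (h2 2)).sub ((h1 2).mul (h2 0))))).add
    ((h0 2).mul (((h1 0).mul (h2 1)).sub ((h1 1).mul (h2 0)))))

lemma continuousOn_wedge {f g : M → ℝ} (hf : ContMDiff (𝓡∂ 2) 𝓘(ℝ, ℝ) ∞ f)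
    (hg : ContMDiff (𝓡∂ 2) 𝓘(ℝ, ℝ) ∞ g) (q : M) :
    ContinuousOn (fun u => wedge (coordDeriv q f u) (coordDeriv q g u))
      (extChartAt (𝓡∂ 2) q).target := by
  obtain ⟨O, hO, hU⟩ := exists_isOpen_target_eq q
  have h1 := fun i => continuousOn_fderivWithin_apply hO hU (contDiffOn_comp_extChartAt_symm hf q)
    (coordVec i)
  have h2 := fun i => continuousOn_fderivWithin_apply hO hU (contDiffOn_comp_extChartAt_symm hg q)
    (coordVec i)
  exact ((h1 0).mul (h2 1)).sub ((h1 1).mul (h2 0))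

lemma continuousOn_coordForm (hx : ContMDiff (𝓡∂ 2) 𝓘(ℝ, Space) ∞ x) {f₀ f₁ : M → ℝ}
    (hf₀ : ContMDiff (𝓡∂ 2) 𝓘(ℝ, ℝ) ∞ f₀) (hf₁ : ContMDiff (𝓡∂ 2) 𝓘(ℝ, ℝ) ∞ f₁) (q : M) :
    ContinuousOn (coordForm x f₀ f₁ q) (extChartAt (𝓡∂ 2) q).target :=
  (continuousOn_wedge hf₀ (contMDiff_coord hx 1) q).sub
    (continuousOn_wedge hf₁ (contMDiff_coord hx 0) q)

/-- In the fixed chart at q the density is a quotient of continuous functions with nonvanishing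
denominator; compact support does the rest. -/
lemma integrableOn_mul_formDensity (hx : Manifold.IsImmersion (𝓡∂ 2) 𝓘(ℝ, Space) ∞ x)
    (hN : IsGaussMap x N) {f₀ f₁ : M → ℝ} (hf₀ : ContMDiff (𝓡∂ 2) 𝓘(ℝ, ℝ) ∞ f₀)
    (hf₁ : ContMDiff (𝓡∂ 2) 𝓘(ℝ, ℝ) ∞ f₁) {h : M → ℝ} (hh : ContMDiff (𝓡∂ 2) 𝓘(ℝ, ℝ) ∞ h) {q : M}
    {K : Set M} (hK : IsCompact K) (hKs : K ⊆ (extChartAt (𝓡∂ 2) q).source)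
    (h0 : ∀ p ∉ K, h p * formDensity x N f₀ f₁ p = 0) :
    IntegrableOn (fun u => h ((extChartAt (𝓡∂ 2) q).symm u)
      * formDensity x N f₀ f₁ ((extChartAt (𝓡∂ 2) q).symm u) * |areaDensity x N q u|)
      (extChartAt (𝓡∂ 2) q).target := by
  refine integrableOn_target_of_continuousOn hK hKs ?_ fun u hu huK => by rw [h0 _ huK, zero_mul]
  have ha := continuousOn_areaDensity hx.contMDiff hN.contMDiff q
  refine ((((contDiffOn_comp_extChartAt_symm hh q).continuousOn).mul
    ((continuousOn_coordForm hx.contMDiff hf₀ hf₁ q).div ha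
      fun u hu => areaDensity_ne_zero hx hN hu)).mul ha.abs).congr fun u hu => ?_
  have h1 := areaDensity_ne_zero hx hN hu
  change _ = h ((extChartAt (𝓡∂ 2) q).symm u) * (coordForm x f₀ f₁ q u / areaDensity x N q u)
    * |areaDensity x N q u|
  rw [← formDensity_mul_areaDensity hx hN hf₀ hf₁ hu]
  field_simp

lemma sum_formDensity {f₀ f₁ : M → ℝ}
    (hf₀ : ContMDiff (𝓡∂ 2) 𝓘(ℝ, ℝ) ∞ f₀) (hf₁ : ContMDiff (𝓡∂ 2) 𝓘(ℝ, ℝ) ∞ f₁)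
    {t : Finset M} {ρ : M → M → ℝ} (hρ : ∀ i, ContMDiff (𝓡∂ 2) 𝓘(ℝ, ℝ) ∞ (ρ i))
    (hsum : ∀ p, ∑ i ∈ t, ρ i p = 1) (p : M) :
    ∑ i ∈ t, formDensity x N (fun y => ρ i y * f₀ y) (fun y => ρ i y * f₁ y) p
      = formDensity x N f₀ f₁ p := by
  have hu := mem_extChartAt_target (I := 𝓡∂ 2) p
  have h : ∀ f : M → ℝ, ContMDiff (𝓡∂ 2) 𝓘(ℝ, ℝ) ∞ f →
      coordDeriv p f (extChartAt (𝓡∂ 2) p p)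
        = ∑ i ∈ t, coordDeriv p (fun y => ρ i y * f y) (extChartAt (𝓡∂ 2) p p) := by
    intro f hf
    rw [← coordDeriv_sum t (f := fun i y => ρ i y * f y) (fun i _ => (hρ i).mul hf) hu]
    congr 1
    funext y
    rw [← Finset.sum_mul, hsum, one_mul]
  simp only [formDensity, coordForm]
  rw [← Finset.sum_div, h f₀ hf₀, h f₁ hf₁]
  congr 1
  simp only [wedge, sum_apply, Finset.sum_mul, ← Finset.sum_sub_distrib]

/-- The integral of a vanishing two-form `df₀ ∧ dx₁ - df₁ ∧ dx₀`, computed by a partition of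
unity. -/
lemma sum_chartIntegral_eq_zero [CompactSpace M]
    (hx : Manifold.IsImmersion (𝓡∂ 2) 𝓘(ℝ, Space) ∞ x)
    (hN : IsGaussMap x N) {f₀ f₁ : M → ℝ} (hf₀ : ContMDiff (𝓡∂ 2) 𝓘(ℝ, ℝ) ∞ f₀)
    (hf₁ : ContMDiff (𝓡∂ 2) 𝓘(ℝ, ℝ) ∞ f₁) {t : Finset M} {ρ : M → M → ℝ}
    (hρ : ∀ i, ContMDiff (𝓡∂ 2) 𝓘(ℝ, ℝ) ∞ (ρ i)) (hsum : ∀ p, ∑ i ∈ t, ρ i p = 1)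
    (hsupp : ∀ i, tsupport (ρ i) ⊆ (extChartAt (𝓡∂ 2) i).source)
    (hclosed : ∀ p, formDensity x N f₀ f₁ p = 0) :
    ∑ i ∈ t, chartIntegral x N i
      (formDensity x N (fun y => ρ i y * f₀ y) (fun y => ρ i y * f₁ y)) = 0 := by
  set D : M → M → ℝ := fun i =>
    formDensity x N (fun y => ρ i y * f₀ y) (fun y => ρ i y * f₁ y) with hD
  have hm : ∀ i {f : M → ℝ}, ContMDiff (𝓡∂ 2) 𝓘(ℝ, ℝ) ∞ f →
      ContMDiff (𝓡∂ 2) 𝓘(ℝ, ℝ) ∞ fun y => ρ i y * f y := fun i _ hf => (hρ i).mul hf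
  have hcpt : ∀ i, IsCompact (tsupport (ρ i)) := fun i => (isClosed_tsupport _).isCompact
  have hDz : ∀ i, ∀ p ∉ tsupport (ρ i), D i p = 0 := fun i p hp =>
    formDensity_eq_zero_of_notMem_tsupport hp
  -- The integral of `D i` lives in chart i, but only the sum of the `D i` vanishes. A second use of
  -- the partition moves each piece ρⱼ `D i` to chart j; there, after the sums are exchanged, the `D
  -- i` add up to the density of the closed form.
  have h1 : ∀ i ∈ t, chartIntegral x N i (D i)
      = ∑ j ∈ t, chartIntegral x N j (fun p => ρ j p * D i p) := by
    intro i _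
    have e : chartIntegral x N i (D i)
        = ∑ j ∈ t, chartIntegral x N i (fun p => ρ j p * D i p) := by
      unfold chartIntegral
      rw [← integral_finsetSum]
      · congr 1
        funext u
        rw [← Finset.sum_mul, ← Finset.sum_mul, hsum, one_mul]
      · intro j _
        exact integrableOn_mul_formDensity hx hN (hm i hf₀) (hm i hf₁) (hρ j)
          (hcpt i) (hsupp i) fun p hp => by
            rw [formDensity_eq_zero_of_notMem_tsupport hp, mul_zero]
    rw [e]
    refine Finset.sum_congr rfl fun j _ => chartIntegral_congr hx.contMDiff fun p hp => ⟨?_, ?_⟩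
    · by_contra h
      exact right_ne_zero_of_mul hp (hDz i p fun h' => h (hsupp i h'))
    · by_contra h
      exact left_ne_zero_of_mul hp (image_eq_zero_of_notMem_tsupport fun h' => h (hsupp j h'))
  rw [Finset.sum_congr rfl h1, Finset.sum_comm]
  refine Finset.sum_eq_zero fun j _ => ?_
  unfold chartIntegral
  rw [← integral_finsetSum]
  · refine integral_eq_zero_of_ae (Eventually.of_forall fun u => ?_)
    simp only [Pi.zero_apply]
    rw [← Finset.sum_mul, ← Finset.mul_sum,
      sum_formDensity hf₀ hf₁ hρ hsum, hclosed, mul_zero, zero_mul]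
  · intro i _
    exact integrableOn_mul_formDensity hx hN (hm i hf₀) (hm i hf₁) (hρ j)
      (hcpt j) (hsupp j) fun p hp => by rw [image_eq_zero_of_notMem_tsupport hp, zero_mul]

/-- The orientation sign of the chart at `q`. -/
noncomputable def chartSign (x N : M → Space) (q : M) (u : EuclideanSpace ℝ (Fin 2)) : ℝ :=
  SignType.sign (areaDensity x N q u)

/-- The area density is continuous and has no zero. Local constancy suffices to differentiate past
the sign, and a chart domain need not be connected. -/
lemma chartSign_eventuallyEq (hx : Manifold.IsImmersion (𝓡∂ 2) 𝓘(ℝ, Space) ∞ x)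
    (hN : IsGaussMap x N) {q : M} {u : EuclideanSpace ℝ (Fin 2)}
    (hu : u ∈ (extChartAt (𝓡∂ 2) q).target) :
    ∀ᶠ v in 𝓝[range (𝓡∂ 2)] u, chartSign x N q v = chartSign x N q u := by
  have h1 : ContinuousWithinAt (areaDensity x N q) (range (𝓡∂ 2)) u :=
    (continuousOn_areaDensity hx.contMDiff hN.contMDiff q u hu).mono_of_mem_nhdsWithin
      (extChartAt_target_mem_nhdsWithin_of_mem hu)
  have h2 := (continuousAt_sign_of_ne_zero (areaDensity_ne_zero hx hN hu)).tendsto.comp h1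
  rw [nhds_discrete, tendsto_pure] at h2
  filter_upwards [h2] with v hv
  simp only [chartSign]
  exact congrArg _ hv

lemma continuous_indicator_boundary {U O K : Set (EuclideanSpace ℝ (Fin 2))} (hO : IsOpen O)
    (hU : U = O ∩ range (𝓡∂ 2)) (hK : IsCompact K) (hKU : K ⊆ U)
    {f : EuclideanSpace ℝ (Fin 2) → ℝ} (hf : ContinuousOn f U) (hfK : ∀ u ∈ U, u ∉ K → f u = 0) :
    Continuous (fun t : ℝ => U.indicator f !₂[0, t]) ∧
      HasCompactSupport (fun t : ℝ => U.indicator f !₂[0, t]) := by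
  constructor
  · rw [← continuousOn_univ]
    refine (continuousOn_indicator_of_eq_zero hO hU hK hKU hf hfK).comp
      (planeEquiv.continuous.comp (Continuous.prodMk_right (0 : ℝ))).continuousOn ?_
    intro t _
    rw [range_halfPlane]
    change 0 ≤ planeEquiv (0, t) 0
    rw [planeEquiv_zero]
  · refine HasCompactSupport.intro (hK.image (f := fun u : EuclideanSpace ℝ (Fin 2) => u 1)
      (by fun_prop)) fun t ht => indicator_eq_zero_of_notMem hfK _ fun h => ht ⟨_, h, by simp⟩

/-- **Stokes' theorem** in the chart at `q` for the one-form `f₀ dx₁ - f₁ dx₀`. -/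
lemma chartIntegral_formDensity (hx : Manifold.IsImmersion (𝓡∂ 2) 𝓘(ℝ, Space) ∞ x)
    (hN : IsGaussMap x N) {f₀ f₁ : M → ℝ} (hf₀ : ContMDiff (𝓡∂ 2) 𝓘(ℝ, ℝ) ∞ f₀)
    (hf₁ : ContMDiff (𝓡∂ 2) 𝓘(ℝ, ℝ) ∞ f₁) {q : M} {K : Set M} (hK : IsCompact K)
    (hKs : K ⊆ (extChartAt (𝓡∂ 2) q).source) (h₀ : ∀ p ∉ K, f₀ p = 0) (h₁ : ∀ p ∉ K, f₁ p = 0) :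
    chartIntegral x N q (formDensity x N f₀ f₁) = -∫ t : ℝ,
      (extChartAt (𝓡∂ 2) q).target.indicator (fun u => chartSign x N q u *
        (f₀ ((extChartAt (𝓡∂ 2) q).symm u) * coordDeriv q (fun p => x p 1) u (coordVec 1)
        - f₁ ((extChartAt (𝓡∂ 2) q).symm u) * coordDeriv q (fun p => x p 0) u (coordVec 1)))
      !₂[0, t] := by
  set φ := extChartAt (𝓡∂ 2) q with hφ
  obtain ⟨O, hO, hU⟩ := exists_isOpen_target_eq q
  rw [← hφ] at hU
  have hc : IsCompact (φ '' K) := hK.image_of_continuousOn ((continuousOn_extChartAt q).mono hKs)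
  have hsub : φ '' K ⊆ φ.target := by
    rintro _ ⟨p, hp, rfl⟩
    exact φ.map_source (hKs hp)
  have hnot : ∀ u ∈ φ.target, u ∉ φ '' K → φ.symm u ∉ K := fun u hu hn hk =>
    hn ⟨_, hk, φ.right_inv hu⟩
  have hs : ∀ u ∈ φ.target, chartSign x N q =ᶠ[𝓝[range (𝓡∂ 2)] u] fun _ => chartSign x N q u :=
    fun u hu => chartSign_eventuallyEq hx hN hu
  have key : ∀ f : M → ℝ, ContMDiff (𝓡∂ 2) 𝓘(ℝ, ℝ) ∞ f → (∀ p ∉ K, f p = 0) → ∀ i : Fin 3,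
      (∫ u in φ.target, chartSign x N q u
        * wedge (coordDeriv q f u) (coordDeriv q (fun p => x p i) u)
        = -∫ t : ℝ, φ.target.indicator (fun u => chartSign x N q u * (f (φ.symm u)
          * coordDeriv q (fun p => x p i) u (coordVec 1))) !₂[0, t]) ∧
      IntegrableOn (fun u => chartSign x N q u
        * wedge (coordDeriv q f u) (coordDeriv q (fun p => x p i) u)) φ.target ∧
      Integrable (fun t : ℝ => φ.target.indicator (fun u => chartSign x N q u * (f (φ.symm u)
          * coordDeriv q (fun p => x p i) u (coordVec 1))) !₂[0, t]) := by
    intro f hf hfK i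
    have hg := contMDiff_coord hx.contMDiff i
    -- Absorbing the locally constant sign into the compactly supported factor keeps it smooth, with
    -- dF = sign · df, so the half-plane theorem applies to all components of the chart at once.
    set F : EuclideanSpace ℝ (Fin 2) → ℝ := fun u => chartSign x N q u * f (φ.symm u) with hF
    have hFev : ∀ u ∈ φ.target, F =ᶠ[𝓝[range (𝓡∂ 2)] u]
        fun v => chartSign x N q u * (f ∘ φ.symm) v := by
      intro u hu
      filter_upwards [hs u hu] with v hv
      simp only [hF, hv, Function.comp_apply]
    have hFc : ContDiffOn ℝ ∞ F φ.target := fun u hu =>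
      (contDiffWithinAt_const.mul (contDiffOn_comp_extChartAt_symm hf q u hu)).congr_of_eventuallyEq
        ((hFev u hu).filter_mono (nhdsWithin_mono _ (extChartAt_target_subset_range q))) rfl
    have hFd : ∀ u ∈ φ.target, fderivWithin ℝ F (range (𝓡∂ 2)) u
        = chartSign x N q u • coordDeriv q f u := by
      intro u hu
      have h1 := ((hasFDerivWithinAt_coordDeriv hf q hu).const_mul
        (chartSign x N q u)).congr_of_eventuallyEq (hFev u hu) rfl
      exact h1.fderivWithin ((𝓡∂ 2).uniqueDiffOn u (extChartAt_target_subset_range q hu))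
    have hFK : ∀ u ∈ φ.target, u ∉ φ '' K → F u = 0 := fun u hu hn => by
      simp only [hF, hfK _ (hnot u hu hn), mul_zero]
    have hst := integral_wedge_halfPlane hO hU hc hsub hFc
      (contDiffOn_comp_extChartAt_symm hg q) hFK
    have hw : ∀ u ∈ φ.target, wedge (fderivWithin ℝ F (range (𝓡∂ 2)) u)
        (coordDeriv q (fun p => x p i) u) = chartSign x N q u
          * wedge (coordDeriv q f u) (coordDeriv q (fun p => x p i) u) := by
      intro u hu
      rw [hFd u hu]
      simp only [wedge, smul_apply, smul_eq_mul]
      ring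
    have hFdc := fun i => continuousOn_fderivWithin_apply hO hU hFc (coordVec i)
    have hgc := fun i => continuousOn_fderivWithin_apply hO hU
      (contDiffOn_comp_extChartAt_symm hg q) (coordVec i)
    have hB : (fun u => chartSign x N q u * (f (φ.symm u)
        * coordDeriv q (fun p => x p i) u (coordVec 1)))
        = fun u => F u * coordDeriv q (fun p => x p i) u (coordVec 1) := by
      funext u
      simp only [hF, mul_assoc]
    refine ⟨?_, ?_, ?_⟩
    · rw [hB, ← setIntegral_congr_fun (measurableSet_target q) hw]
      exact hst
    · refine IntegrableOn.congr_fun ?_ hw (measurableSet_target q)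
      refine integrableOn_target_of_continuousOn hK hKs
        (((hFdc 0).mul (hgc 1)).sub ((hFdc 1).mul (hgc 0))) fun u hu hn => ?_
      have hd := fderivWithin_eq_zero_of_notMem hO hU hc hFK hu fun ⟨p, hp, hpu⟩ => hn (by
        rw [← hpu, φ.left_inv (hKs hp)]; exact hp)
      simp only [wedge, hd, zero_apply, zero_mul, sub_self]
    · rw [hB]
      obtain ⟨h1, h2⟩ := continuous_indicator_boundary hO hU hc hsub
        (hFc.continuousOn.mul (hgc 1)) (fun u hu hn => by
          rw [Pi.mul_apply, hFK u hu hn, zero_mul])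
      exact h1.integrable_of_hasCompactSupport h2
  obtain ⟨a1, a2, a3⟩ := key f₀ hf₀ h₀ 1
  obtain ⟨b1, b2, b3⟩ := key f₁ hf₁ h₁ 0
  -- Since |d| = sign(d) · d for the area density d, the unsigned area integral is the integral of
  -- the two-form times the chart sign.
  have e1 : chartIntegral x N q (formDensity x N f₀ f₁)
      = ∫ u in φ.target, (chartSign x N q u
          * wedge (coordDeriv q f₀ u) (coordDeriv q (fun p => x p 1) u)
        - chartSign x N q u * wedge (coordDeriv q f₁ u) (coordDeriv q (fun p => x p 0) u)) := by
    refine setIntegral_congr_fun (measurableSet_target q) fun u hu => ?_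
    have h2 := formDensity_mul_areaDensity hx hN hf₀ hf₁ hu
    simp only
    rw [← mul_sub]
    change _ = _ * coordForm x f₀ f₁ q u
    rw [← h2, chartSign, ← sign_mul_self]
    ring
  rw [e1, integral_sub a2 b2, a1, b1, ← neg_sub', ← integral_sub a3 b3]
  congr 2
  funext t
  rw [← Pi.sub_apply, ← indicator_sub']
  congr 1
  funext u
  simp only [Pi.sub_apply]
  ring

end Stokes

/-! ### The flux form is closed; boundary behaviour of charts -/

section Main

variable {M : Type*} [TopologicalSpace M] [ChartedSpace (EuclideanHalfSpace 2) M]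

/-- The component `N i + (a r² / 4 + b / 2) x i` of the vector field of the flux formula. -/
noncomputable def fluxField (a b : ℝ) (x N : M → Space) (i : Fin 3) (p : M) : ℝ :=
  N p i + (a / 4 * (x p 0 * x p 0 + x p 1 * x p 1) + b / 2) * x p i

lemma axisDist_sq (y : Space) : axisDist y ^ 2 = y 0 * y 0 + y 1 * y 1 := by
  rw [axisDist, Real.sq_sqrt (by positivity)]
  ring

variable {x N : M → Space} {a b : ℝ}

lemma contMDiff_fluxField (hx : ContMDiff (𝓡∂ 2) 𝓘(ℝ, Space) ∞ x)
    (hN : ContMDiff (𝓡∂ 2) 𝓘(ℝ, Space) ∞ N) (i : Fin 3) :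
    ContMDiff (𝓡∂ 2) 𝓘(ℝ, ℝ) ∞ (fluxField a b x N i) :=
  (contMDiff_coord hN i).add ((((contMDiff_const (c := a / 4)).mul
    (((contMDiff_coord hx 0).mul (contMDiff_coord hx 0)).add
      ((contMDiff_coord hx 1).mul (contMDiff_coord hx 1)))).add (contMDiff_const (c := b / 2))).mul
    (contMDiff_coord hx i))

variable [IsManifold (𝓡∂ 2) ∞ M]

/-- Differentiate |N|² = 1. -/
lemma inner_coordDeriv_gaussMap (hN : IsGaussMap x N) {q : M} {u : EuclideanSpace ℝ (Fin 2)}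
    (hu : u ∈ (extChartAt (𝓡∂ 2) q).target) (v : EuclideanSpace ℝ (Fin 2)) :
    inner ℝ (coordDeriv q N u v) (N ((extChartAt (𝓡∂ 2) q).symm u)) = 0 := by
  have h := hasFDerivWithinAt_coordDeriv hN.contMDiff q hu
  have h1 := h.inner ℝ h
  have h2 : (fun t => inner ℝ ((N ∘ (extChartAt (𝓡∂ 2) q).symm) t)
      ((N ∘ (extChartAt (𝓡∂ 2) q).symm) t)) = fun _ => (1 : ℝ) := by
    funext t
    simp only [Function.comp_apply, real_inner_self_eq_norm_sq, hN.norm_eq_one, one_pow]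
  rw [h2] at h1
  have h3 := ((𝓡∂ 2).uniqueDiffOn u (extChartAt_target_subset_range q hu)).eq h1
    (hasFDerivWithinAt_const (1 : ℝ) u _)
  have h4 := congrArg (fun L : EuclideanSpace ℝ (Fin 2) →L[ℝ] ℝ => L v) h3
  simp only [ContinuousLinearMap.comp_apply, ContinuousLinearMap.prod_apply, fderivInnerCLM_apply,
    Function.comp_apply, zero_apply] at h4
  rw [real_inner_comm] at h4
  linarith

/-- The equation 2H = a r² + b enters here. The factor h = a r²/4 + b/2 is chosen so that the planar
field h · (x₀, x₁) has divergence a r² + b, which cancels the mean curvature term produced by N. -/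
lemma fluxField_formDensity (hM : IsStationaryRotating a b x N) (p : M) :
    formDensity x N (fluxField a b x N 0) (fluxField a b x N 1) p = 0 := by
  have hx := hM.immersion.contMDiff
  have hN := hM.gauss
  have hu := mem_extChartAt_target (I := 𝓡∂ 2) p
  set u := extChartAt (𝓡∂ 2) p p with hudef
  have hup : (extChartAt (𝓡∂ 2) p).symm u = p := extChartAt_to_inv p
  have hdx : differential x p = coordDeriv p x u :=
    differential_eq_coordDeriv (hx.mdifferentiableAt (by simp))
  have hdN : differential N p = coordDeriv p N u :=
    differential_eq_coordDeriv (hN.contMDiff.mdifferentiableAt (by simp))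
  have hA : ∀ v, inner ℝ (coordDeriv p N u v) (N p) = 0 := fun v => by
    have := inner_coordDeriv_gaussMap hN hu v
    rwa [hup] at this
  have hB : ∀ v, inner ℝ (coordDeriv p x u v) (N p) = 0 := fun v => by
    have := hN.orthogonal p v
    rwa [hdx] at this
  have hd := areaDensity_ne_zero hM.immersion hN hu
  rw [areaDensity, hup] at hd
  have htr := trace_mul_det3 (hN.norm_eq_one p) (hA (coordVec 0)) (hA (coordVec 1))
    (hB (coordVec 0)) (hB (coordVec 1)) hd (firstForm x p) (secondForm x N p)
    (by ext i j; fin_cases i <;> fin_cases j <;> simp [firstForm, hdx])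
    (by ext i j; fin_cases i <;> fin_cases j <;> simp [secondForm, hdx, hdN])
  have hH : ((firstForm x p)⁻¹ * secondForm x N p).trace
      = a * (x p 0 * x p 0 + x p 1 * x p 1) + b := by
    rw [← axisDist_sq, ← hM.laplace p, meanCurvature]
    ring
  rw [hH] at htr
  have c1 := (cross_eq_det3_mul (hN.norm_eq_one p) (hA (coordVec 0)) (hB (coordVec 1))).2.2
  have c2 := (cross_eq_det3_mul (hN.norm_eq_one p) (hB (coordVec 0)) (hA (coordVec 1))).2.2
  have c3 := (cross_eq_det3_mul (hN.norm_eq_one p) (hB (coordVec 0)) (hB (coordVec 1))).2.2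
  have k := fun i => contMDiff_coord hx i
  have kk := (contMDiff_const (I := 𝓡∂ 2) (M := M) (n := ∞) (c := a / 4)).mul
    (((k 0).mul (k 0)).add ((k 1).mul (k 1)))
  have hderiv : ∀ i v, coordDeriv p (fluxField a b x N i) u v = coordDeriv p N u v i
      + ((a / 4 * (x p 0 * x p 0 + x p 1 * x p 1) + b / 2) * coordDeriv p x u v i
        + x p i * (a / 4 * (2 * x p 0 * coordDeriv p x u v 0 + 2 * x p 1 * coordDeriv p x u v 1)))
        := by
    intro i v
    have h0 := hasFDerivWithinAt_coordDeriv (k 0) p hu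
    have h1 := hasFDerivWithinAt_coordDeriv (k 1) p hu
    have hi := hasFDerivWithinAt_coordDeriv (k i) p hu
    have hn := hasFDerivWithinAt_coordDeriv (contMDiff_coord hN.contMDiff i) p hu
    have hfull := hn.add (((((h0.mul h0).add (h1.mul h1)).const_mul (a / 4)).add_const
      (b / 2)).mul hi)
    rw [coordDeriv_eq_of_hasFDerivWithinAt (f := fluxField a b x N i) hu hfull]
    simp only [add_apply, smul_apply, smul_eq_mul, Function.comp_apply, hup,
      coordDeriv_coord hx _ hu, coordDeriv_coord hN.contMDiff _ hu, Pi.add_apply, Pi.mul_apply]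
    ring
  have hform : coordForm x (fluxField a b x N 0) (fluxField a b x N 1) p u = 0 := by
    simp only [coordForm, wedge, hderiv, coordDeriv_coord hx _ hu]
    -- `c1` and `c2` turn the N-terms into N₂ times the mixed triple products, `c3` turns dx₀ ∧ dx₁
    -- into N₂ times the area density, and `htr` balances the two.
    linear_combination c1 + c2 + (a * (x p 0 * x p 0 + x p 1 * x p 1) + b) * c3 + N p 2 * htr
  rw [formDensity, hform, zero_div]

/-- The angular velocity of the second coordinate curve about the axis, times `r²`. -/
noncomputable def angularDensity (x : M → Space) (q : M) (u : EuclideanSpace ℝ (Fin 2)) : ℝ :=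
  x ((extChartAt (𝓡∂ 2) q).symm u) 0 * coordDeriv q x u (coordVec 1) 1
    - x ((extChartAt (𝓡∂ 2) q).symm u) 1 * coordDeriv q x u (coordVec 1) 0

/-- The derivative along the boundary of a function that is constant on the boundary vanishes. -/
lemma coordDeriv_eq_zero_of_boundary {f : M → ℝ} (hf : ContMDiff (𝓡∂ 2) 𝓘(ℝ, ℝ) ∞ f) {C : ℝ}
    (hC : ∀ p ∈ (𝓡∂ 2).boundary M, f p = C) {q : M} {u : EuclideanSpace ℝ (Fin 2)}
    (hu : u ∈ (extChartAt (𝓡∂ 2) q).target) (h0 : u 0 = 0) :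
    coordDeriv q f u (coordVec 1) = 0 := by
  have hmaps : ∀ s : ℝ, u + s • coordVec 1 ∈ range (𝓡∂ 2) := by
    intro s
    rw [range_halfPlane]
    simp [h0, coordVec]
  have hline : HasDerivAt (fun s : ℝ => u + s • coordVec 1) (coordVec 1) 0 := by
    simpa using ((hasDerivAt_id (0 : ℝ)).smul_const (coordVec 1)).const_add u
  have hd := hasFDerivWithinAt_coordDeriv hf q hu
  have hu0 : u = u + (0 : ℝ) • coordVec 1 := by simp
  have hd' : HasFDerivWithinAt (f ∘ (extChartAt (𝓡∂ 2) q).symm) (coordDeriv q f u) (range (𝓡∂ 2))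
      (u + (0 : ℝ) • coordVec 1) := by rwa [← hu0]
  have h1 := hd'.comp_hasDerivAt (0 : ℝ) hline (Eventually.of_forall hmaps)
  obtain ⟨O, hO, hU⟩ := exists_isOpen_target_eq q
  have h2 : (f ∘ (extChartAt (𝓡∂ 2) q).symm) ∘ (fun s : ℝ => u + s • coordVec 1)
      =ᶠ[𝓝 0] fun _ => C := by
    have hc : ContinuousAt (fun s : ℝ => u + s • coordVec 1) 0 := hline.continuousAt
    have hO' : O ∈ 𝓝 (u + (0 : ℝ) • coordVec 1) := by
      rw [← hu0]; exact hO.mem_nhds (hU ▸ hu : u ∈ O ∩ range (𝓡∂ 2)).1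
    filter_upwards [hc hO'] with s hs
    refine hC _ ((mem_boundary_iff (hU ▸ ⟨hs, hmaps s⟩)).2 ?_)
    simp [h0, coordVec]
  exact (h1.congr_of_eventuallyEq h2.symm).unique (hasDerivAt_const 0 C)

/-- At a boundary point the transition derivative T is triangular. The area density is scaled by T₀₀
T₁₁ and the angular density by T₁₁, hence the product by T₀₀ T₁₁². This is nonnegative because T₀₀ ≥
0, and nonzero by `hne`. -/
lemma sign_areaDensity_mul_angularDensity (hx : ContMDiff (𝓡∂ 2) 𝓘(ℝ, Space) ∞ x) {q q' : M}
    {u : EuclideanSpace ℝ (Fin 2)} (hu : u ∈ (extChartAt (𝓡∂ 2) q).target)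
    (hu' : (extChartAt (𝓡∂ 2) q).symm u ∈ (extChartAt (𝓡∂ 2) q').source) (h0 : u 0 = 0)
    (hne : areaDensity x N q u * angularDensity x q u ≠ 0) :
    SignType.sign (areaDensity x N q u * angularDensity x q u) = SignType.sign
      (areaDensity x N q' (extChartAt (𝓡∂ 2) q' ((extChartAt (𝓡∂ 2) q).symm u))
        * angularDensity x q' (extChartAt (𝓡∂ 2) q' ((extChartAt (𝓡∂ 2) q).symm u))) := by
  have hb := (mem_boundary_iff hu).2 h0
  have h0' : extChartAt (𝓡∂ 2) q' ((extChartAt (𝓡∂ 2) q).symm u) 0 = 0 := by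
    rw [← mem_boundary_iff ((extChartAt (𝓡∂ 2) q').map_source hu'),
      (extChartAt (𝓡∂ 2) q').left_inv hu']
    exact hb
  obtain ⟨t1, t0⟩ := transition_boundary hu hu' h0 h0'
  set T := coordDeriv q (extChartAt (𝓡∂ 2) q') u with hT
  set u' := extChartAt (𝓡∂ 2) q' ((extChartAt (𝓡∂ 2) q).symm u) with hu'def
  have ha : areaDensity x N q u = T (coordVec 0) 0 * T (coordVec 1) 1 * areaDensity x N q' u' := by
    rw [areaDensity_eq hx hu hu', det_eq, ← hT, t1]
    ring
  have hl : angularDensity x q u = T (coordVec 1) 1 * angularDensity x q' u' := by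
    rw [angularDensity, angularDensity, coordDeriv_eq_comp hx hu hu',
      (extChartAt (𝓡∂ 2) q').left_inv hu', ← hT, ← hu'def, ContinuousLinearMap.comp_apply,
      apply_eq_sum _ (T (coordVec 1)), t1]
    simp only [zero_smul, zero_add, PiLp.smul_apply, smul_eq_mul]
    ring
  have hm : areaDensity x N q u * angularDensity x q u = (T (coordVec 0) 0 * T (coordVec 1) 1 ^ 2)
      * (areaDensity x N q' u' * angularDensity x q' u') := by
    rw [ha, hl]; ring
  have hpos : 0 < T (coordVec 0) 0 * T (coordVec 1) 1 ^ 2 := by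
    refine lt_of_le_of_ne (by positivity) fun h => hne ?_
    rw [hm, ← h, zero_mul]
  rw [hm, sign_mul, sign_pos hpos, one_mul]

end Main

/-! ### The sign of the flux form on the boundary circle, and the contradiction -/

section Boundary

variable {M : Type*} [TopologicalSpace M] [ChartedSpace (EuclideanHalfSpace 2) M]
  {x N : M → Space} {a b R c : ℝ}

lemma coord_of_mem_boundary (hΓ : IsBoundedBy x (horizontalCircle R c)) {p : M}
    (hp : p ∈ (𝓡∂ 2).boundary M) : x p 0 * x p 0 + x p 1 * x p 1 = R ^ 2 ∧ x p 2 = c := by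
  have h : x p ∈ horizontalCircle R c := hΓ.image_eq ▸ mem_image_of_mem x hp
  exact ⟨by rw [← axisDist_sq, h.1], h.2⟩

lemma isPreconnected_horizontalCircle (hR : 0 < R) : IsPreconnected (horizontalCircle R c) := by
  have h : horizontalCircle R c
      = (fun θ : ℝ => (!₂[R * Real.cos θ, R * Real.sin θ, c] : Space)) '' univ := by
    ext y
    constructor
    · rintro ⟨h1, h2⟩
      have h3 : y 0 * y 0 + y 1 * y 1 = R ^ 2 := by rw [← axisDist_sq, h1]
      set z : ℂ := ⟨y 0, y 1⟩ with hz
      have hzn : ‖z‖ = R := by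
        rw [Complex.norm_def, Complex.normSq_mk, h3, Real.sqrt_sq hR.le]
      refine ⟨z.arg, mem_univ _, ?_⟩
      have e0 : R * Real.cos z.arg = y 0 := by rw [← hzn, Complex.norm_mul_cos_arg]
      have e1 : R * Real.sin z.arg = y 1 := by rw [← hzn, Complex.norm_mul_sin_arg]
      ext i
      fin_cases i
      · simpa using e0
      · simpa using e1
      · simpa using h2.symm
    · rintro ⟨θ, -, rfl⟩
      refine ⟨?_, by simp⟩
      have : (R * Real.cos θ) ^ 2 + (R * Real.sin θ) ^ 2 = R ^ 2 := by
        linear_combination R ^ 2 * Real.cos_sq_add_sin_sq θ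
      simp [axisDist, this, Real.sqrt_sq hR.le]
  rw [h]
  refine isPreconnected_univ.image _ (Continuous.continuousOn ?_)
  fun_prop

/-- The embedding hypothesis enters here: connectedness of the circle is pulled back along the
restriction of x to the boundary. -/
lemma isPreconnected_boundary (hR : 0 < R) (hΓ : IsBoundedBy x (horizontalCircle R c)) :
    IsPreconnected ((𝓡∂ 2).boundary M) := by
  have h1 : IsPreconnected (univ : Set ((𝓡∂ 2).boundary M)) := by
    rw [← hΓ.isEmbedding.isInducing.isPreconnected_image, image_univ, range_domRestrict,
      hΓ.image_eq]
    exact isPreconnected_horizontalCircle hR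
  simpa using h1.image Subtype.val continuous_subtype_val.continuousOn

lemma boundary_nonempty (hR : 0 < R) (hΓ : IsBoundedBy x (horizontalCircle R c)) :
    ((𝓡∂ 2).boundary M).Nonempty := by
  rw [← image_nonempty, hΓ.image_eq]
  exact ⟨!₂[R, 0, c], by simp [axisDist, Real.sqrt_sq hR.le], by simp⟩

variable [IsManifold (𝓡∂ 2) ∞ M]

/-- On a boundary circle of radius `R` the coefficient of the one-form
`(N₀ + h x₀) dx₁ - (N₁ + h x₁) dx₀`, `h = a R² / 4 + b / 2`, has the sign of `h` relative to the
direction of rotation if `|h| R > 1`. -/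
lemma fluxForm_boundary_pos (hM : IsStationaryRotating a b x N) (hR : 0 < R)
    (hΓ : IsBoundedBy x (horizontalCircle R c)) (hc : 1 < |a / 4 * R ^ 2 + b / 2| * R) {q : M}
    {u : EuclideanSpace ℝ (Fin 2)} (hu : u ∈ (extChartAt (𝓡∂ 2) q).target) (h0 : u 0 = 0) :
    angularDensity x q u ≠ 0 ∧ 0 < (a / 4 * R ^ 2 + b / 2) *
      (fluxField a b x N 0 ((extChartAt (𝓡∂ 2) q).symm u)
          * coordDeriv q (fun p => x p 1) u (coordVec 1)
        - fluxField a b x N 1 ((extChartAt (𝓡∂ 2) q).symm u)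
          * coordDeriv q (fun p => x p 0) u (coordVec 1)) * angularDensity x q u := by
  have hx := hM.immersion.contMDiff
  have k := fun i => contMDiff_coord hx i
  have hb := (mem_boundary_iff hu).2 h0
  have hz := coordDeriv_eq_zero_of_boundary (k 2) (C := c)
    (fun p hp => (coord_of_mem_boundary hΓ hp).2) hu h0
  have hsq := coordDeriv_eq_zero_of_boundary (f := fun p => x p 0 * x p 0 + x p 1 * x p 1)
    (((k 0).mul (k 0)).add ((k 1).mul (k 1))) (C := R ^ 2)
    (fun p hp => (coord_of_mem_boundary hΓ hp).1) hu h0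
  have hr := (coord_of_mem_boundary hΓ hb).1
  rw [coordDeriv_add (f := fun p => x p 0 * x p 0) (g := fun p => x p 1 * x p 1)
    ((k 0).mul (k 0)) ((k 1).mul (k 1)) hu, coordDeriv_mul (k 0) (k 0) hu,
    coordDeriv_mul (k 1) (k 1) hu] at hsq
  simp only [add_apply, smul_apply, smul_eq_mul, coordDeriv_coord hx _ hu] at hsq hz ⊢
  have hn := sum_sq_eq_one (hM.gauss.norm_eq_one ((extChartAt (𝓡∂ 2) q).symm u))
  have hd := areaDensity_ne_zero hM.immersion hM.gauss hu
  simp only [areaDensity, angularDensity, fluxField, det3] at hd ⊢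
  rw [hr]
  generalize x ((extChartAt (𝓡∂ 2) q).symm u) = y at *
  generalize N ((extChartAt (𝓡∂ 2) q).symm u) = n at *
  generalize coordDeriv q x u (coordVec 1) = v at *
  generalize coordDeriv q x u (coordVec 0) = w at *
  generalize a / 4 * R ^ 2 + b / 2 = h at *
  set l := y 0 * v 1 - y 1 * v 0 with hl
  -- The boundary velocity v is orthogonal to the radius, so R² v = l (-y₁, y₀, 0). If l were 0, v
  -- would vanish, against the nonvanishing area density.
  have hv1 : R ^ 2 * v 1 = l * y 0 := by rw [hl]; linear_combination (-v 1) * hr + y 1 / 2 * hsq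
  have hv0 : R ^ 2 * v 0 = -(l * y 1) := by rw [hl]; linear_combination (-v 0) * hr + y 0 / 2 * hsq
  have hR2 : 0 < R ^ 2 := by positivity
  have hl0 : l ≠ 0 := by
    intro hl0
    rw [hl0, zero_mul] at hv1
    rw [hl0, zero_mul, neg_zero] at hv0
    have e1 := (mul_eq_zero.1 hv1).resolve_left hR2.ne'
    have e0 := (mul_eq_zero.1 hv0).resolve_left hR2.ne'
    rw [e0, e1, hz] at hd
    apply hd
    ring
  refine ⟨hl0, ?_⟩
  have hcs : |n 0 * y 0 + n 1 * y 1| ≤ R := by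
    apply abs_le_of_sq_le_sq _ hR.le
    nlinarith [sq_nonneg (n 0 * y 1 - n 1 * y 0), mul_nonneg (sq_nonneg (n 2)) hR2.le]
  -- By Cauchy–Schwarz the first term is at least -|h|R, and |h|R > 1 gives h²R² > |h|R.
  have hkey : 0 < h * (n 0 * y 0 + n 1 * y 1) + h ^ 2 * R ^ 2 := by
    have h1 : -(|h| * R) ≤ h * (n 0 * y 0 + n 1 * y 1) := by
      have := abs_mul h (n 0 * y 0 + n 1 * y 1)
      have h2 := neg_abs_le (h * (n 0 * y 0 + n 1 * y 1))
      have h3 := mul_le_mul_of_nonneg_left hcs (abs_nonneg h)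
      linarith
    have h2 : h ^ 2 * R ^ 2 = (|h| * R) * (|h| * R) := by rw [← sq_abs h]; ring
    nlinarith
  have hfin : R ^ 2 * (h * ((n 0 + h * y 0) * v 1 - (n 1 + h * y 1) * v 0) * l)
      = l ^ 2 * (h * (n 0 * y 0 + n 1 * y 1) + h ^ 2 * R ^ 2) := by
    linear_combination h * l * (n 0 + h * y 0) * hv1 - h * l * (n 1 + h * y 1) * hv0
      + l ^ 2 * h ^ 2 * hr
  have hpos : 0 < l ^ 2 * (h * (n 0 * y 0 + n 1 * y 1) + h ^ 2 * R ^ 2) := by positivity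
  rw [← hfin] at hpos
  exact pos_of_mul_pos_right hpos hR2.le

/-- The boundary orientation relative to the direction of rotation about the axis. -/
noncomputable def boundarySign (x N : M → Space) (p : M) : SignType :=
  SignType.sign (areaDensity x N p (extChartAt (𝓡∂ 2) p p)
    * angularDensity x p (extChartAt (𝓡∂ 2) p p))

lemma continuousOn_angularDensity (hx : ContMDiff (𝓡∂ 2) 𝓘(ℝ, Space) ∞ x) (q : M) :
    ContinuousOn (angularDensity x q) (extChartAt (𝓡∂ 2) q).target := by
  obtain ⟨O, hO, hU⟩ := exists_isOpen_target_eq q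
  have hv := continuousOn_fderivWithin_apply hO hU (contDiffOn_comp_extChartAt_symm hx q)
    (coordVec 1)
  have hy := (contDiffOn_comp_extChartAt_symm hx q).continuousOn
  have hc : ∀ {f : EuclideanSpace ℝ (Fin 2) → Space} {s : Set (EuclideanSpace ℝ (Fin 2))}
      (i : Fin 3), ContinuousOn f s → ContinuousOn (fun u => f u i) s := fun i hf =>
    (EuclideanSpace.proj i : Space →L[ℝ] ℝ).continuous.comp_continuousOn hf
  exact ((hc 0 hy).mul (hc 1 hv)).sub ((hc 1 hy).mul (hc 0 hv))

lemma boundarySign_eq (hx : ContMDiff (𝓡∂ 2) 𝓘(ℝ, Space) ∞ x)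
    {q : M} {u : EuclideanSpace ℝ (Fin 2)} (hu : u ∈ (extChartAt (𝓡∂ 2) q).target) (h0 : u 0 = 0)
    (hne : areaDensity x N q u * angularDensity x q u ≠ 0) :
    boundarySign x N ((extChartAt (𝓡∂ 2) q).symm u)
      = SignType.sign (areaDensity x N q u * angularDensity x q u) :=
  (sign_areaDensity_mul_angularDensity hx hu (mem_extChartAt_source _) h0 hne).symm

/-- Near a boundary point all signs can be read in one fixed chart, by `boundarySign_eq`. There they
are the sign of a continuous nonvanishing function, hence locally constant, and the boundary is
connected. -/
lemma boundarySign_eq_of_mem_boundary (hM : IsStationaryRotating a b x N) (hR : 0 < R)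
    (hΓ : IsBoundedBy x (horizontalCircle R c))
    (hne : ∀ (q : M) (u : EuclideanSpace ℝ (Fin 2)), u ∈ (extChartAt (𝓡∂ 2) q).target → u 0 = 0 →
      areaDensity x N q u * angularDensity x q u ≠ 0) {p p' : M}
    (hp : p ∈ (𝓡∂ 2).boundary M) (hp' : p' ∈ (𝓡∂ 2).boundary M) :
    boundarySign x N p = boundarySign x N p' := by
  have hx := hM.immersion.contMDiff
  refine (isPreconnected_boundary hR hΓ).constant (f := boundarySign x N) ?_ hp hp'
  intro p₀ hp₀
  have hut := mem_extChartAt_target (I := 𝓡∂ 2) p₀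
  have hu0 : extChartAt (𝓡∂ 2) p₀ p₀ 0 = 0 := by
    rw [← mem_boundary_iff hut, extChartAt_to_inv]
    exact hp₀
  set g : EuclideanSpace ℝ (Fin 2) → ℝ := fun u => areaDensity x N p₀ u * angularDensity x p₀ u
  have hg : ContinuousOn g (extChartAt (𝓡∂ 2) p₀).target :=
    (continuousOn_areaDensity hx hM.gauss.contMDiff p₀).mul (continuousOn_angularDensity hx p₀)
  have hgφ : ContinuousWithinAt (g ∘ extChartAt (𝓡∂ 2) p₀) (extChartAt (𝓡∂ 2) p₀).source p₀ :=
    (hg _ hut).comp (continuousAt_extChartAt p₀).continuousWithinAt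
      fun y hy => (extChartAt (𝓡∂ 2) p₀).map_source hy
  have hgc : ContinuousAt (g ∘ extChartAt (𝓡∂ 2) p₀) p₀ :=
    hgφ.continuousAt (extChartAt_source_mem_nhds p₀)
  have hs : ContinuousAt (fun y => SignType.sign (g (extChartAt (𝓡∂ 2) p₀ y))) p₀ :=
    ContinuousAt.comp (g := SignType.sign) (continuousAt_sign_of_ne_zero (hne p₀ _ hut hu0)) hgc
  refine hs.continuousWithinAt.congr_of_eventuallyEq ?_ rfl
  filter_upwards [self_mem_nhdsWithin,
    mem_nhdsWithin_of_mem_nhds (extChartAt_source_mem_nhds (I := 𝓡∂ 2) p₀)] with y hy hys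
  have hyt := (extChartAt (𝓡∂ 2) p₀).map_source hys
  have hy0 : extChartAt (𝓡∂ 2) p₀ y 0 = 0 := by
    rw [← mem_boundary_iff hyt, (extChartAt (𝓡∂ 2) p₀).left_inv hys]
    exact hy
  have := boundarySign_eq hx hyt hy0 (hne p₀ _ hyt hy0)
  rwa [(extChartAt (𝓡∂ 2) p₀).left_inv hys] at this

lemma exists_finite_partition [T2Space M] [CompactSpace M] :
    ∃ (t : Finset M) (ρ : M → M → ℝ), (∀ i, ContMDiff (𝓡∂ 2) 𝓘(ℝ, ℝ) ∞ (ρ i)) ∧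
      (∀ i p, 0 ≤ ρ i p) ∧ (∀ p, ∑ i ∈ t, ρ i p = 1) ∧
      ∀ i, tsupport (ρ i) ⊆ (extChartAt (𝓡∂ 2) i).source := by
  obtain ⟨f, hf⟩ := SmoothPartitionOfUnity.exists_isSubordinate_chartAt_source (𝓡∂ 2) M
  have hfin := f.locallyFinite.finite_nonempty_of_compact
  refine ⟨hfin.toFinset, fun i => f i, fun i => (f i).contMDiff, fun i p => f.nonneg i p,
    fun p => ?_, fun i => by rw [extChartAt_source]; exact hf i⟩
  rw [← f.sum_eq_one (mem_univ p)]
  refine (finsum_eq_sum_of_support_subset _ fun i hi => ?_).symm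
  simp only [Finite.coe_toFinset, mem_ofPred_eq]
  exact ⟨p, hi⟩

/-- The consequence of the flux formula for a stationary rotating surface bounded by a horizontal
circle of radius `R`. -/
lemma abs_le_of_isBoundedBy [T2Space M] [CompactSpace M] (hM : IsStationaryRotating a b x N)
    (hR : 0 < R) (hΓ : IsBoundedBy x (horizontalCircle R c)) :
    |a / 4 * R ^ 2 + b / 2| * R ≤ 1 := by
  by_contra! hc
  have hx := hM.immersion.contMDiff
  have hN := hM.gauss
  have hne : ∀ (q : M) (u : EuclideanSpace ℝ (Fin 2)), u ∈ (extChartAt (𝓡∂ 2) q).target →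
      u 0 = 0 → areaDensity x N q u * angularDensity x q u ≠ 0 := fun q u hu h0 =>
    mul_ne_zero (areaDensity_ne_zero hM.immersion hN hu)
      (fluxForm_boundary_pos hM hR hΓ hc hu h0).1
  obtain ⟨p₀, hp₀⟩ := boundary_nonempty hR hΓ
  obtain ⟨t, ρ, hρ, hρ0, hsum, hsupp⟩ := exists_finite_partition (M := M)
  have hY := fun i => contMDiff_fluxField (a := a) (b := b) hx hN.contMDiff i
  -- The factor k carries the common orientation sign of the boundary and the sign of h, so that k
  -- times every boundary integrand is nonnegative.
  set k : ℝ := (boundarySign x N p₀ : ℝ) * (a / 4 * R ^ 2 + b / 2) with hk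
  set B : M → EuclideanSpace ℝ (Fin 2) → ℝ := fun i u => chartSign x N i u *
    (ρ i ((extChartAt (𝓡∂ 2) i).symm u) * fluxField a b x N 0 ((extChartAt (𝓡∂ 2) i).symm u)
      * coordDeriv i (fun p => x p 1) u (coordVec 1)
    - ρ i ((extChartAt (𝓡∂ 2) i).symm u) * fluxField a b x N 1 ((extChartAt (𝓡∂ 2) i).symm u)
      * coordDeriv i (fun p => x p 0) u (coordVec 1)) with hB
  set β : M → ℝ → ℝ := fun i s => (extChartAt (𝓡∂ 2) i).target.indicator (B i) !₂[0, s] with hβ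
  have hcpt : ∀ i, IsCompact (tsupport (ρ i)) := fun i => (isClosed_tsupport _).isCompact
  have hzero : ∑ i ∈ t, ∫ s : ℝ, β i s = 0 := by
    have h := sum_chartIntegral_eq_zero hM.immersion hN (hY 0) (hY 1) hρ hsum hsupp
      (fluxField_formDensity hM)
    rw [Finset.sum_congr rfl fun i _ => chartIntegral_formDensity hM.immersion hN
      (f₀ := fun y => ρ i y * fluxField a b x N 0 y) (f₁ := fun y => ρ i y * fluxField a b x N 1 y)
      ((hρ i).mul (hY 0)) ((hρ i).mul (hY 1))
      (hcpt i) (hsupp i) (fun p hp => by rw [image_eq_zero_of_notMem_tsupport hp, zero_mul])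
      (fun p hp => by rw [image_eq_zero_of_notMem_tsupport hp, zero_mul])] at h
    rw [Finset.sum_neg_distrib, neg_eq_zero] at h
    exact h
  have hfac : ∀ i u, u ∈ (extChartAt (𝓡∂ 2) i).target → u 0 = 0 →
      ∃ m : ℝ, 0 < m ∧ k * B i u = ρ i ((extChartAt (𝓡∂ 2) i).symm u) * m := by
    intro i u hu h0
    obtain ⟨hl, hpos⟩ := fluxForm_boundary_pos hM hR hΓ hc hu h0
    have hs := boundarySign_eq hx hu h0 (hne i u hu h0)
    rw [boundarySign_eq_of_mem_boundary hM hR hΓ hne ((mem_boundary_iff hu).2 h0) hp₀,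
      sign_mul] at hs
    set A := fluxField a b x N 0 ((extChartAt (𝓡∂ 2) i).symm u)
        * coordDeriv i (fun p => x p 1) u (coordVec 1)
      - fluxField a b x N 1 ((extChartAt (𝓡∂ 2) i).symm u)
        * coordDeriv i (fun p => x p 0) u (coordVec 1) with hA
    have ha1 : chartSign x N i u * chartSign x N i u = 1 := by
      have := areaDensity_ne_zero hM.immersion hN hu
      rcases lt_or_gt_of_ne this with h | h <;> simp [chartSign, h]
    refine ⟨k * chartSign x N i u * A, ?_, by rw [hB, hA]; ring⟩
    -- The boundary sign is the product of the signs of the area and angular densities. The area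
    -- sign squares to 1 against the chart sign, leaving the quantity whose positivity is `hpos`, up
    -- to the factor |angular density|.
    have hk' : k * chartSign x N i u * A = SignType.sign (angularDensity x i u)
        * ((a / 4 * R ^ 2 + b / 2) * A) := by
      rw [hk, hs, SignType.coe_mul]
      change chartSign x N i u * _ * _ * _ * _ = _
      linear_combination (SignType.sign (angularDensity x i u) : ℝ)
        * ((a / 4 * R ^ 2 + b / 2) * A) * ha1
    rw [hk']
    have h2 : 0 < (SignType.sign (angularDensity x i u) * ((a / 4 * R ^ 2 + b / 2) * A))
        * |angularDensity x i u| := by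
      have := sign_mul_abs (angularDensity x i u)
      calc (0 : ℝ) < _ := hpos
        _ = (a / 4 * R ^ 2 + b / 2) * A
            * (SignType.sign (angularDensity x i u) * |angularDensity x i u|) := by rw [this]
        _ = _ := by ring
    exact pos_of_mul_pos_left h2 (abs_nonneg _)
  have hline : ∀ s : ℝ, (!₂[0, s] : EuclideanSpace ℝ (Fin 2)) 0 = 0 := fun s => by simp
  have hnonneg : ∀ i s, 0 ≤ k * β i s := by
    intro i s
    by_cases hs : !₂[0, s] ∈ (extChartAt (𝓡∂ 2) i).target
    · obtain ⟨m, hm, he⟩ := hfac i _ hs (hline s)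
      simp only [hβ, indicator_of_mem hs, he]
      exact mul_nonneg (hρ0 i _) hm.le
    · simp only [hβ, indicator_of_notMem hs, mul_zero, le_refl]
  -- Some cut-off is nonzero at p₀, so its continuous nonnegative boundary integrand is nonzero
  -- there and has positive integral, while the total is zero.
  obtain ⟨i, hit, hi⟩ : ∃ i ∈ t, ρ i p₀ ≠ 0 :=
    Finset.exists_ne_zero_of_sum_ne_zero (by rw [hsum p₀]; exact one_ne_zero)
  have his : p₀ ∈ (extChartAt (𝓡∂ 2) i).source := hsupp i (subset_tsupport _ hi)
  have hut := (extChartAt (𝓡∂ 2) i).map_source his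
  have hu0 : extChartAt (𝓡∂ 2) i p₀ 0 = 0 := by
    rw [← mem_boundary_iff hut, (extChartAt (𝓡∂ 2) i).left_inv his]
    exact hp₀
  have hucoord : !₂[0, extChartAt (𝓡∂ 2) i p₀ 1] = extChartAt (𝓡∂ 2) i p₀ := by
    ext j
    fin_cases j
    · exact hu0.symm
    · rfl
  have hval : k * β i (extChartAt (𝓡∂ 2) i p₀ 1) ≠ 0 := by
    obtain ⟨m, hm, he⟩ := hfac i _ hut hu0
    simp only [hβ, hucoord, indicator_of_mem hut, he, (extChartAt (𝓡∂ 2) i).left_inv his]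
    exact mul_ne_zero hi hm.ne'
  have hcont : Continuous (β i) ∧ HasCompactSupport (β i) := by
    obtain ⟨O, hO, hU⟩ := exists_isOpen_target_eq i
    refine continuous_indicator_boundary hO hU (K := extChartAt (𝓡∂ 2) i '' tsupport (ρ i))
      ((hcpt i).image_of_continuousOn ((continuousOn_extChartAt i).mono (hsupp i))) ?_ ?_ ?_
    · rintro _ ⟨p, hp, rfl⟩
      exact (extChartAt (𝓡∂ 2) i).map_source (hsupp i hp)
    · have hcs : ContinuousOn (chartSign x N i) (extChartAt (𝓡∂ 2) i).target := fun u hu =>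
        (continuousWithinAt_const.congr_of_eventuallyEq
          (chartSign_eventuallyEq hM.immersion hN hu) rfl).mono (extChartAt_target_subset_range i)
      have hd := fun j => continuousOn_fderivWithin_apply hO hU
        (contDiffOn_comp_extChartAt_symm (contMDiff_coord hx j) i) (coordVec 1)
      have hf := fun j => (contDiffOn_comp_extChartAt_symm (hY j) i).continuousOn
      have hr := (contDiffOn_comp_extChartAt_symm (hρ i) i).continuousOn
      exact hcs.mul (((hr.mul (hf 0)).mul (hd 1)).sub ((hr.mul (hf 1)).mul (hd 0)))
    · intro u hu hn
      have : ρ i ((extChartAt (𝓡∂ 2) i).symm u) = 0 := image_eq_zero_of_notMem_tsupport fun h =>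
        hn ⟨_, h, (extChartAt (𝓡∂ 2) i).right_inv hu⟩
      simp only [hB, this, zero_mul, sub_self, mul_zero]
  have hpos : 0 < ∫ s, k * β i s :=
    (continuous_const.mul hcont.1).integral_pos_of_hasCompactSupport_nonneg_nonzero
      hcont.2.mul_left (hnonneg i) hval
  have hlt : 0 < ∑ j ∈ t, ∫ s, k * β j s :=
    Finset.sum_pos' (fun j _ => integral_nonneg (hnonneg j)) ⟨i, hit, hpos⟩
  simp only [integral_const_mul] at hlt
  rw [← Finset.mul_sum, hzero, mul_zero] at hlt
  exact hlt.false

end Boundary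

end RotatingSurface

theorem mainTheorem12 {M : Type*} [TopologicalSpace M] [T2Space M] [CompactSpace M]
    [ConnectedSpace M] [ChartedSpace (EuclideanHalfSpace 2) M] [IsManifold (𝓡∂ 2) ∞ M]
    (x N : M → RotatingSurface.Space) (a b R c : ℝ) (hR : 0 < R)
    (hM : RotatingSurface.IsStationaryRotating a b x N)
    (hΓ : RotatingSurface.IsBoundedBy x (RotatingSurface.horizontalCircle R c)) :
    |a * R ^ 2 + 2 * b| ≤ 4 / R ∧
      (a = 0 → ∀ p, |RotatingSurface.meanCurvature x N p| ≤ 1 / R) := by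
  have h := RotatingSurface.abs_le_of_isBoundedBy hM hR hΓ
  have h1 : |a * R ^ 2 + 2 * b| ≤ 4 / R := by
    rw [le_div_iff₀ hR, show a * R ^ 2 + 2 * b = 4 * (a / 4 * R ^ 2 + b / 2) by ring, abs_mul,
      abs_of_pos (by norm_num : (0 : ℝ) < 4)]
    linarith
  refine ⟨h1, fun ha p => ?_⟩
  have h2 := hM.laplace p
  rw [ha, zero_mul, zero_add] at h2
  rw [ha, zero_mul, zero_add, ← h2, show (4 : ℝ) / R = 4 * (1 / R) by ring,
    show ∀ H : ℝ, 2 * (2 * H) = 4 * H by intro H; ring, abs_mul,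
    abs_of_pos (by norm_num : (0 : ℝ) < 4)] at h1
  linarith
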